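/- Let $m$ be a positive integer and let $E_{i,j}$ denote the matrix units. For $\mu=(\mu_1,\dots,\mu_m)\in\mathbb C^m$ let $M(\mu)$ be the Verma module over $\mathfrak{gl}(m)=\mathfrak{gl}(m,\mathbb C)$, that is, the module induced from the one-dimensional module $\mathbb C v_\mu$ over the upper triangular matrices on which $E_{i,i}$ acts by $\mu_i$ and $E_{i,j}$ $(i<j)$ acts by $0$, and let $V=L(\mu)$ be the simple $\mathfrak{gl}(m)$-module with highest weight $\mu$, that is, the quotient of $M(\mu)$ by its largest proper submodule (the sum of all its proper submodules). Let $\mathfrak p=\mathfrak l\oplus\mathfrak u\subset\mathfrak{sl}(m+1)=\mathfrak{sl}(m+1,\mathbb C)$, where $\mathfrak l=\mathrm{span}\{E_{i,j},\,E_{i,i}-E_{m+1,m+1}\mid 1\le i\ne j\le m\}$ and $\mathfrak u=\mathrm{span}\{E_{s,m+1}\mid 1\le s\le m\}$. Regard $V$ as a $\mathfrak p$-module through the isomorphism $\mathfrak l\cong\mathfrak{gl}(m)$, $E_{i,j}\mapsto E_{i,j}$ $(i\neq j)$, $E_{i,i}-E_{m+1,m+1}\mapsto E_{i,i}$, and $\mathfrak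 u V=0$, and let $$M_{\mathfrak p}(V)=U(\mathfrak{sl}(m+1))\otimes_{U(\mathfrak p)}V$$ be the generalized Verma module. Let $\mu\in\mathbb C^m$ be arbitrary. If for every $i\in\{1,\dots,m\}$ the number $\mu_i+m+1$ is not a positive integer, then $M_{\mathfrak p}(V)$ is a simple $\mathfrak{sl}(m+1)$-module. -/

import Mathlib

open scoped TensorProduct

attribute [local instance 100] LieRing.ofAssociativeRing

section Induction

variable {R L : Type} [CommRing R] [LieRing L] [LieAlgebra R L]

/-- For a Lie subalgebra `P` of `L` and a representation `ρ` of `P` on `V`, the `U(L)`-submodule of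
`U(L) ⊗[R] V` generated by all `u * x ⊗ v - u ⊗ ρ x v` with `u ∈ U(L)`, `x ∈ P`, `v ∈ V`. -/
def indRelations (P : LieSubalgebra R L) {V : Type} [AddCommGroup V] [Module R V]
    (ρ : P →ₗ⁅R⁆ Module.End R V) :
    Submodule (UniversalEnvelopingAlgebra R L) (UniversalEnvelopingAlgebra R L ⊗[R] V) :=
  Submodule.span (UniversalEnvelopingAlgebra R L)
    {t | ∃ (u : UniversalEnvelopingAlgebra R L) (x : P) (v : V),
      t = (u * UniversalEnvelopingAlgebra.ι R (x : L)) ⊗ₜ[R] v - u ⊗ₜ[R] (ρ x v)}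

/-- The induced module `Ind_P^L V = U(L) ⊗_{U(P)} V`: the quotient of `U(L) ⊗[R] V` by the
relations `u * x ⊗ v = u ⊗ ρ x v`, `x ∈ P`, which balance the tensor product over `U(P)`
because `P` generates `U(P)`. -/
def Ind (P : LieSubalgebra R L) {V : Type} [AddCommGroup V] [Module R V]
    (ρ : P →ₗ⁅R⁆ Module.End R V) : Type :=
  (UniversalEnvelopingAlgebra R L ⊗[R] V) ⧸ indRelations P ρ

namespace Ind

variable (P : LieSubalgebra R L) {V : Type} [AddCommGroup V] [Module R V]
  (ρ : P →ₗ⁅R⁆ Module.End R V)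

noncomputable instance : AddCommGroup (Ind P ρ) :=
  inferInstanceAs (AddCommGroup ((UniversalEnvelopingAlgebra R L ⊗[R] V) ⧸ indRelations P ρ))

noncomputable instance : Module (UniversalEnvelopingAlgebra R L) (Ind P ρ) :=
  inferInstanceAs (Module (UniversalEnvelopingAlgebra R L)
    ((UniversalEnvelopingAlgebra R L ⊗[R] V) ⧸ indRelations P ρ))

noncomputable instance : Module R (Ind P ρ) :=
  inferInstanceAs (Module R ((UniversalEnvelopingAlgebra R L ⊗[R] V) ⧸ indRelations P ρ))

instance : IsScalarTower R (UniversalEnvelopingAlgebra R L) (Ind P ρ) :=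
  inferInstanceAs (IsScalarTower R (UniversalEnvelopingAlgebra R L)
    ((UniversalEnvelopingAlgebra R L ⊗[R] V) ⧸ indRelations P ρ))

/-- `L` acts through left multiplication by its image in `U(L)`. -/
noncomputable instance : LieRingModule L (Ind P ρ) where
  bracket x t := UniversalEnvelopingAlgebra.ι R x • t
  add_lie x y t := by
    rw [map_add, add_smul]
  lie_add x s t := smul_add _ s t
  leibniz_lie x y t := by
    change UniversalEnvelopingAlgebra.ι R x • UniversalEnvelopingAlgebra.ι R y • t =
      UniversalEnvelopingAlgebra.ι R ⁅x, y⁆ • t +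
        UniversalEnvelopingAlgebra.ι R y • UniversalEnvelopingAlgebra.ι R x • t
    rw [LieHom.map_lie, LieRing.of_associative_ring_bracket, sub_smul, mul_smul, mul_smul,
      sub_add_cancel]

instance : LieModule R L (Ind P ρ) where
  smul_lie c x t := by
    change UniversalEnvelopingAlgebra.ι R (c • x) • t = c • UniversalEnvelopingAlgebra.ι R x • t
    rw [map_smul, smul_assoc]
  lie_smul c x t := by
    change UniversalEnvelopingAlgebra.ι R x • c • t = c • UniversalEnvelopingAlgebra.ι R x • t
    rw [← algebraMap_smul (UniversalEnvelopingAlgebra R L) c t,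
      ← algebraMap_smul (UniversalEnvelopingAlgebra R L) c, smul_smul, smul_smul,
      Algebra.commutes]

end Ind

end Induction

/-- The general linear Lie algebra `gl(m)` over `ℂ`, with the commutator bracket. -/
abbrev Gl (m : ℕ) : Type := Matrix (Fin m) (Fin m) ℂ

/-- The special linear Lie algebra `sl(m)` over `ℂ`. -/
abbrev Sl (m : ℕ) : LieSubalgebra ℂ (Gl m) := LieAlgebra.SpecialLinear.sl (Fin m) ℂ

/-- The standard Borel subalgebra of `gl(m)`: the upper triangular matrices. -/
def borelGl (m : ℕ) : LieSubalgebra ℂ (Gl m) where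
  carrier := {X | ∀ i j : Fin m, j < i → X i j = 0}
  add_mem' {X Y} hX hY i j h := by simp [hX i j h, hY i j h]
  zero_mem' i j _ := rfl
  smul_mem' c X hX i j h := by simp [hX i j h]
  lie_mem' {X Y} hX hY i j h := by
    have key : ∀ A B : Gl m, (∀ i j : Fin m, j < i → A i j = 0) →
        (∀ i j : Fin m, j < i → B i j = 0) → (A * B) i j = 0 := by
      intro A B hA hB
      rw [Matrix.mul_apply]
      refine Finset.sum_eq_zero fun k _ => ?_
      rcases lt_or_ge k i with hk | hk
      · rw [hA i k hk, zero_mul]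
      · rw [hB k j (lt_of_lt_of_le h hk), mul_zero]
    change (X * Y - Y * X) i j = 0
    rw [Matrix.sub_apply, key X Y hX hY, key Y X hY hX, sub_zero]

/-- On upper triangular matrices the diagonal of a product is the product of the diagonals. -/
theorem borelGl_mul_diag {m : ℕ} (X Y : borelGl m) (i : Fin m) :
    ((X : Gl m) * (Y : Gl m)) i i = (X : Gl m) i i * (Y : Gl m) i i := by
  rw [Matrix.mul_apply]
  refine Finset.sum_eq_single i (fun k _ hk => ?_) (by simp)
  rcases lt_or_gt_of_ne hk with h | h
  · rw [X.2 i k h, zero_mul]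
  · rw [Y.2 k i h, mul_zero]

/-- The one-dimensional representation `ℂ v_μ` of the Borel subalgebra: `E i i` acts by `μ i` and
`E i j` with `i < j` acts by zero. -/
noncomputable def borelRep (m : ℕ) (μ : Fin m → ℂ) : borelGl m →ₗ⁅ℂ⁆ Module.End ℂ ℂ where
  toFun X := (∑ i, μ i * (X : Gl m) i i) • (1 : Module.End ℂ ℂ)
  map_add' X Y := by
    rw [← add_smul, ← Finset.sum_add_distrib]
    simp [mul_add]
  map_smul' c X := by
    rw [RingHom.id_apply, smul_smul, Finset.mul_sum]
    simp [mul_left_comm]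
  map_lie' {X Y} := by
    have h : ∀ i, ((⁅X, Y⁆ : borelGl m) : Gl m) i i = 0 := by
      intro i
      change ((X : Gl m) * (Y : Gl m) - (Y : Gl m) * (X : Gl m)) i i = 0
      rw [Matrix.sub_apply, borelGl_mul_diag, borelGl_mul_diag, mul_comm, sub_self]
    simp only [h, mul_zero, Finset.sum_const_zero, zero_smul, LieRing.of_associative_ring_bracket,
      smul_mul_smul_comm, mul_one]
    rw [mul_comm (∑ i, μ i * (Y : Gl m) i i), sub_self]

/-- The Verma module `M(μ)` over `gl(m)`. -/
abbrev Verma (m : ℕ) (μ : Fin m → ℂ) : Type := Ind (borelGl m) (borelRep m μ)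

/-- The sum of all proper submodules of the Verma module, that is, its largest proper submodule. -/
noncomputable def Verma.radical (m : ℕ) (μ : Fin m → ℂ) : LieSubmodule ℂ (Gl m) (Verma m μ) :=
  sSup {N | N ≠ ⊤}

/-- The simple highest weight module `L(μ)` over `gl(m)`: the simple quotient of `M(μ)`. -/
abbrev SimpleHW (m : ℕ) (μ : Fin m → ℂ) : Type := Verma m μ ⧸ Verma.radical m μ

/-- The maximal parabolic subalgebra `p = l ⊕ u` of `sl(m+1)`, where `l` consists of the block
diagonal matrices (blocks of sizes `m` and `1`) and `u` is spanned by the `E s (m+1)`, `s ≤ m`: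
the traceless matrices whose last row vanishes off the diagonal. -/
def parabolic (m : ℕ) : LieSubalgebra ℂ (Sl (m + 1)) where
  carrier := {X | ∀ j : Fin m, (X : Gl (m + 1)) (Fin.last m) j.castSucc = 0}
  add_mem' {X Y} hX hY j := by simp [hX j, hY j]
  zero_mem' j := rfl
  smul_mem' c X hX j := by simp [hX j]
  lie_mem' {X Y} hX hY j := by
    change ((X : Gl (m + 1)) * (Y : Gl (m + 1)) - (Y : Gl (m + 1)) * (X : Gl (m + 1)))
      (Fin.last m) j.castSucc = 0
    rw [Matrix.sub_apply, Matrix.mul_apply, Matrix.mul_apply, Fin.sum_univ_castSucc,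
      Fin.sum_univ_castSucc]
    simp [hX _, hY _]

/-- The projection `p → l ≅ gl(m)` with kernel `u`, onto the upper left block. The identification
of `l` with `gl(m)` sends `E i j` to `E i j` for `i ≠ j` and `E i i - E (m+1) (m+1)` to `E i i`. -/
def leviProj (m : ℕ) : parabolic m →ₗ⁅ℂ⁆ Gl m where
  toFun X := Matrix.of fun i j : Fin m => ((X : Sl (m + 1)) : Gl (m + 1)) i.castSucc j.castSucc
  map_add' X Y := rfl
  map_smul' c X := rfl
  map_lie' {X Y} := by
    ext i j
    change (((X : Sl (m + 1)) : Gl (m + 1)) * ((Y : Sl (m + 1)) : Gl (m + 1)) -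
      ((Y : Sl (m + 1)) : Gl (m + 1)) * ((X : Sl (m + 1)) : Gl (m + 1))) i.castSucc j.castSucc = _
    rw [LieRing.of_associative_ring_bracket, Matrix.sub_apply, Matrix.sub_apply, Matrix.mul_apply,
      Matrix.mul_apply, Matrix.mul_apply, Matrix.mul_apply, Fin.sum_univ_castSucc,
      Fin.sum_univ_castSucc, X.2 j, Y.2 j]
    simp

/-- The generalized Verma module `M_p(V)` over `sl(m+1)`, where the `gl(m)`-module `V` is made a
`p`-module through `l ≅ gl(m)` and `u V = 0`. -/
abbrev GenVerma (m : ℕ) (V : Type) [AddCommGroup V] [Module ℂ V] [LieRingModule (Gl m) V]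
    [LieModule ℂ (Gl m) V] : Type :=
  Ind (parabolic m) ((LieModule.toEnd ℂ (Gl m) V).comp (leviProj m))

/-! ### Universal properties of the enveloping algebra and of induced modules -/

section Induction

variable {R L : Type} [CommRing R] [LieRing L] [LieAlgebra R L]

/-! The module is modelled on `ℂ[y₁, …, y_m] ⊗ V`: the last row of `sl(m+1)` acts by multiplication
by the `y_t`, and the last column by second-order operators X_s, which lower the degree by one. On
the part of degree k+1, X_s sends w to Σ_t E_st ∂_t w - k ∂_s w (`homProj_X`). If all X_s kill w,
the column (∂_s w)_s is therefore, coefficient by coefficient, an eigenvector with eigenvalue k of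
the matrix (E_st) acting on V^m.

The matrix (E_st) commutes with gl(m) acting on V ⊗ (ℂ^m)^*. Filtering this tensor product by the
submodules generated by the v ⊗ e_j^* with j ≥ k, v a highest weight vector, shows that every
eigenvalue is among the numbers μ_j + m - 1 - j, with j counted from 0
(`IsHighestWeightGenerator.eq_zero_of_unitMatrixAct_eq_smul`). The hypothesis prevents these from
being natural numbers, so vectors killed by all X_s have degree 0
(`exists_eq_one_tmul_of_X_eq_zero`).

Applying the X_s repeatedly, any nonzero submodule of the model reaches a nonzero 1 ⊗ v; simplicity
of V and the multiplications by y_t then produce everything (`polyTensor_eq_top`). An equivariant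
surjection from the model onto the generalized Verma module carries the result over
(`GenVerma.exists_equivariant`). The same model, built up one rank at a time, shows that gl(m) Verma
modules are nonzero, so the Poincaré–Birkhoff–Witt theorem is never invoked. -/

theorem UniversalEnvelopingAlgebra.mem_of_forall_ι_mem
    (S : Subalgebra R (UniversalEnvelopingAlgebra R L))
    (h : ∀ x : L, UniversalEnvelopingAlgebra.ι R x ∈ S) (u : UniversalEnvelopingAlgebra R L) :
    u ∈ S := by
  let f : L →ₗ⁅R⁆ S :=
    { toFun := fun x => ⟨UniversalEnvelopingAlgebra.ι R x, h x⟩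
      map_add' := fun x y => Subtype.ext (map_add _ x y)
      map_smul' := fun c x => Subtype.ext (map_smul _ c x)
      map_lie' := fun {x y} => Subtype.ext (LieHom.map_lie _ x y) }
  -- Two algebra endomorphisms of U(L) that agree on L coincide; the left one takes values in `S`.
  have key : S.val.comp (UniversalEnvelopingAlgebra.lift R f) = AlgHom.id R _ := by
    refine UniversalEnvelopingAlgebra.hom_ext R (LieHom.ext fun x => ?_)
    change ((UniversalEnvelopingAlgebra.lift R f (UniversalEnvelopingAlgebra.ι R x) : S) :
      UniversalEnvelopingAlgebra R L) = UniversalEnvelopingAlgebra.ι R x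
    rw [UniversalEnvelopingAlgebra.lift_ι_apply]
    rfl
  have := DFunLike.congr_fun key u
  change ((UniversalEnvelopingAlgebra.lift R f u : S) : UniversalEnvelopingAlgebra R L) = u at this
  rw [← this]
  exact Subtype.property _

namespace Ind

variable (P : LieSubalgebra R L) {V : Type} [AddCommGroup V] [Module R V]
  (ρ : P →ₗ⁅R⁆ Module.End R V)

/-- The canonical map `v ↦ 1 ⊗ v` from `V` to the induced module. -/
noncomputable def of : V →ₗ[R] Ind P ρ where
  toFun v := (Submodule.Quotient.mk (1 ⊗ₜ[R] v) :
    (UniversalEnvelopingAlgebra R L ⊗[R] V) ⧸ indRelations P ρ)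
  map_add' v w := by rw [TensorProduct.tmul_add]; rfl
  map_smul' c v := by rw [TensorProduct.tmul_smul]; rfl

theorem smul_of (u : UniversalEnvelopingAlgebra R L) (v : V) :
    u • of P ρ v = (Submodule.Quotient.mk (u ⊗ₜ[R] v) :
      (UniversalEnvelopingAlgebra R L ⊗[R] V) ⧸ indRelations P ρ) := by
  change (Submodule.Quotient.mk (u • (1 ⊗ₜ[R] v)) :
      (UniversalEnvelopingAlgebra R L ⊗[R] V) ⧸ indRelations P ρ) = _
  rw [TensorProduct.smul_tmul', smul_eq_mul, mul_one]

theorem lie_def (x : L) (t : Ind P ρ) : ⁅x, t⁆ = UniversalEnvelopingAlgebra.ι R x • t := rfl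

theorem lie_of (x : P) (v : V) : ⁅(x : L), of P ρ v⁆ = of P ρ (ρ x v) := by
  rw [lie_def, smul_of]
  refine (Submodule.Quotient.eq _).2 (Submodule.subset_span ⟨1, x, v, ?_⟩)
  rw [one_mul]

theorem induction_on {p : Ind P ρ → Prop} (t : Ind P ρ) 
    (smul_of : ∀ (u : UniversalEnvelopingAlgebra R L) v, p (u • of P ρ v))
    (add : ∀ s t, p s → p t → p (s + t)) : p t := by
  obtain ⟨t, rfl⟩ := Submodule.Quotient.mk_surjective _ t
  induction t with
  | zero =>
    have := smul_of 0 0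
    rw [zero_smul] at this
    exact this
  | tmul u v => rw [← Ind.smul_of]; exact smul_of u v
  | add s t hs ht => exact add _ _ hs ht

variable {P ρ}

theorem smul_mem {N : LieSubmodule R L (Ind P ρ)} (u : UniversalEnvelopingAlgebra R L)
    {t : Ind P ρ} (ht : t ∈ N) : u • t ∈ N := by
  let S : Subalgebra R (UniversalEnvelopingAlgebra R L) :=
    { carrier := {u | ∀ t ∈ N, u • t ∈ N}
      mul_mem' := fun {a b} ha hb t ht => by rw [mul_smul]; exact ha _ (hb _ ht)
      add_mem' := fun {a b} ha hb t ht => by rw [add_smul]; exact N.add_mem (ha _ ht) (hb _ ht)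
      algebraMap_mem' := fun r t ht => by rw [algebraMap_smul]; exact N.smul_mem r ht }
  exact UniversalEnvelopingAlgebra.mem_of_forall_ι_mem S (fun x t ht => N.lie_mem ht) u t ht

theorem eq_top_of_forall_of_mem {N : LieSubmodule R L (Ind P ρ)} (h : ∀ v, of P ρ v ∈ N) :
    N = ⊤ := by
  refine eq_top_iff.2 fun t _ => ?_
  induction t using induction_on with
  | smul_of u v => exact smul_mem u (h v)
  | add s t hs ht => exact N.add_mem (hs trivial) (ht trivial)

/-- Frobenius reciprocity: a `P`-equivariant map from `V` to an `L`-module extends to the induced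
module. -/
theorem exists_lift {M : Type} [AddCommGroup M] [Module R M] (τ : L →ₗ⁅R⁆ Module.End R M)
    (f : V →ₗ[R] M) (hf : ∀ (x : P) v, f (ρ x v) = τ x (f v)) :
    ∃ g : Ind P ρ →ₗ[R] M, (∀ (x : L) t, g ⁅x, t⁆ = τ x (g t)) ∧ ∀ v, g (of P ρ v) = f v := by
  set T := UniversalEnvelopingAlgebra.lift R τ with hT
  let g₀ : UniversalEnvelopingAlgebra R L ⊗[R] V →ₗ[R] M :=
    TensorProduct.lift ((LinearMap.lcomp R M f).comp T.toLinearMap)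
  have hg₀ : ∀ u v, g₀ (u ⊗ₜ v) = T u (f v) := fun u v => TensorProduct.lift.tmul _ _
  have hsmul : ∀ u t, g₀ (u • t) = T u (g₀ t) := by
    intro u t
    induction t with
    | zero => simp
    | tmul u' v => rw [TensorProduct.smul_tmul', hg₀, hg₀, smul_eq_mul, map_mul]; rfl
    | add s t hs ht => rw [smul_add, map_add, map_add, map_add, hs, ht]
  have hker : ∀ t ∈ indRelations P ρ, g₀ t = 0 := by
    intro t ht
    induction ht using Submodule.span_induction with
    | mem t ht =>
      obtain ⟨u, x, v, rfl⟩ := ht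
      rw [map_sub, hg₀, hg₀, hf, map_mul, hT, UniversalEnvelopingAlgebra.lift_ι_apply,
        Module.End.mul_apply, sub_self]
    | zero => exact map_zero _
    | add s t _ _ hs ht => rw [map_add, hs, ht, add_zero]
    | smul u t _ ht => rw [hsmul, ht, map_zero]
  let g : Ind P ρ →ₗ[R] M := ((indRelations P ρ).restrictScalars R).liftQ g₀ hker
  have hg : ∀ u v, g (u • of P ρ v) = T u (f v) := by
    intro u v
    rw [smul_of, ← hg₀]
    rfl
  refine ⟨g, fun x t => ?_, fun v => ?_⟩
  · induction t using induction_on with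
    | smul_of u v =>
      rw [lie_def, smul_smul, hg, hg, map_mul, hT, UniversalEnvelopingAlgebra.lift_ι_apply]
      rfl
    | add s t hs ht => rw [lie_add, map_add, hs, ht, map_add, map_add]
  · have := hg 1 v
    rwa [one_smul, map_one, Module.End.one_apply] at this

end Ind

end Induction

/-! ### Lie homomorphisms defined on matrix units -/

section MatrixLieHom

variable {n B : Type} [Fintype n] [DecidableEq n] [Ring B] [Algebra ℂ B]

/-- The Lie algebra homomorphism from matrices determined by images of the matrix units that
satisfy the commutation relations of matrix units. -/
noncomputable def matrixLieHom (op : n → n → B)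
    (h : ∀ i j k l, op i j * op k l =
      op k l * op i j + (if j = k then op i l else 0) - if l = i then op k j else 0) :
    Matrix n n ℂ →ₗ⁅ℂ⁆ B where
  toFun X := ∑ i, ∑ j, X i j • op i j
  map_add' X Y := by simp [add_smul, Finset.sum_add_distrib]
  map_smul' c X := by simp [mul_smul, Finset.smul_sum]
  map_lie' {X Y} := by
    let f : Matrix n n ℂ →ₗ[ℂ] B :=
      { toFun := fun X => ∑ i, ∑ j, X i j • op i j
        map_add' := fun X Y => by simp [add_smul, Finset.sum_add_distrib]
        map_smul' := fun c X => by simp [mul_smul, Finset.smul_sum] }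
    have hf : ∀ i j c, f (Matrix.single i j c) = c • op i j := by
      intro i j c
      change ∑ i', ∑ j', Matrix.single i j c i' j' • op i' j' = _
      simp [Matrix.single_apply, ite_and, Finset.sum_ite_irrel]
    change f ⁅X, Y⁆ = ⁅f X, f Y⁆
    induction X using Matrix.induction_on' with
    | h_zero => simp
    | h_add X X' hX hX' => rw [add_lie, map_add, map_add, add_lie, hX, hX']
    | h_std_basis i j a =>
      induction Y using Matrix.induction_on' with
      | h_zero => simp
      | h_add Y Y' hY hY' => rw [lie_add, map_add, map_add, lie_add, hY, hY']
      | h_std_basis k l b =>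
        rw [hf, hf, LieRing.of_associative_ring_bracket, LieRing.of_associative_ring_bracket,
          map_sub, smul_mul_smul_comm, smul_mul_smul_comm, h i j k l, mul_comm b a]
        have h1 : f (Matrix.single i j a * Matrix.single k l b) =
            (a * b) • if j = k then op i l else 0 := by
          split_ifs with hjk
          · subst hjk; rw [Matrix.single_mul_single_same, hf]
          · rw [Matrix.single_mul_single_of_ne _ _ _ _ hjk, map_zero, smul_zero]
        have h2 : f (Matrix.single k l b * Matrix.single i j a) =
            (a * b) • if l = i then op k j else 0 := by
          split_ifs with hli
          · subst hli; rw [Matrix.single_mul_single_same, hf, mul_comm]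
          · rw [Matrix.single_mul_single_of_ne _ _ _ _ hli, map_zero, smul_zero]
        rw [h1, h2, ← smul_sub, ← smul_sub]
        congr 1
        abel

theorem matrixLieHom_apply (op : n → n → B) (h) (X : Matrix n n ℂ) :
    matrixLieHom op h X = ∑ i, ∑ j, X i j • op i j := rfl

theorem matrixLieHom_single (op : n → n → B) (h) (i j : n) :
    matrixLieHom op h (Matrix.single i j 1) = op i j := by
  simp [matrixLieHom_apply, Matrix.single_apply, ite_and, Finset.sum_ite_irrel]

end MatrixLieHom

/-! ### Operators for `gl(m+1)` from a Weyl algebra and `gl(m)` -/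

/-- Elements `Y t`, `D t` and `E s t` of an algebra that satisfy the relations of the tensor
product of a Weyl algebra with the enveloping algebra of `gl(m)`. -/
structure WeylGl (m : ℕ) (B : Type) [Ring B] where
  Y : Fin m → B
  D : Fin m → B
  E : Fin m → Fin m → B
  Y_mul_Y : ∀ s t, Y s * Y t = Y t * Y s
  D_mul_D : ∀ s t, D s * D t = D t * D s
  D_mul_Y : ∀ s t, D s * Y t = Y t * D s + if s = t then 1 else 0
  E_mul_Y : ∀ s t r, E s t * Y r = Y r * E s t
  E_mul_D : ∀ s t r, E s t * D r = D r * E s t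
  E_mul_E : ∀ i j k l, E i j * E k l =
      E k l * E i j + (if j = k then E i l else 0) - if l = i then E k j else 0

namespace WeylGl

variable {m : ℕ} {B : Type} [Ring B] (W : WeylGl m B)

/-- The operators of the upper left block. -/
def A (s t : Fin m) : B := W.E s t - W.Y t * W.D s

theorem A_mul_D (a b t : Fin m) :
    W.A a b * W.D t = W.D t * W.A a b + if b = t then W.D a else 0 := by
  have h1 := W.E_mul_D a b t
  have h2 := W.D_mul_D a t
  have h3 := W.D_mul_Y t b
  simp only [A]
  rw [sub_mul, mul_sub, h1, mul_assoc, h2, ← mul_assoc, ← mul_assoc, h3, add_mul]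
  rcases eq_or_ne b t with rfl | h
  · simp; abel
  · simp [h, h.symm]

theorem A_mul_Y (a b r : Fin m) :
    W.A a b * W.Y r = W.Y r * W.A a b - if a = r then W.Y b else 0 := by
  have h1 := W.E_mul_Y a b r
  have h2 := W.Y_mul_Y b r
  have h3 := W.D_mul_Y a r
  simp only [A]
  rw [sub_mul, mul_sub, h1, mul_assoc, h3, mul_add, ← mul_assoc, h2]
  split_ifs <;> simp [mul_assoc]
  abel

theorem A_mul_E (a b s t : Fin m) :
    W.A a b * W.E s t = W.E s t * W.A a b + (if b = s then W.E a t else 0) -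
      if t = a then W.E s b else 0 := by
  have h1 := W.E_mul_E a b s t
  have h2 := W.E_mul_D s t a
  have h3 := W.E_mul_Y s t b
  simp only [A]
  rw [sub_mul, mul_sub, h1, mul_assoc, ← h2, ← mul_assoc, ← h3, ← mul_assoc]
  abel

theorem A_mul_A (i j k l : Fin m) : W.A i j * W.A k l =
      W.A k l * W.A i j + (if j = k then W.A i l else 0) - if l = i then W.A k j else 0 := by
  have h1 := W.A_mul_E i j k l
  have h2 := W.A_mul_D i j k
  have h3 := W.A_mul_Y i j l
  conv_lhs => rw [A.eq_1 W k l]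
  conv_rhs => enter [1, 1]; rw [A.eq_1 W k l]
  rw [mul_sub, h1, sub_mul, ← mul_assoc, h3, sub_mul, mul_assoc, h2, mul_add, ← mul_assoc]
  simp only [A]
  rcases eq_or_ne l i with rfl | h
  · split_ifs <;> simp [mul_assoc] <;> abel
  · simp [h, h.symm, mul_assoc]
    split_ifs <;> (try simp) <;> abel

variable [Algebra ℂ B] (c : ℂ)

/-- The operators of the last column. -/
def X (s : Fin m) : B := ∑ t, W.A s t * W.D t - algebraMap ℂ B c * W.D s

/-- The operator of the lower right corner. -/
def Z : B := algebraMap ℂ B c + ∑ r, W.Y r * W.D r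

theorem A_mul_X (a b s : Fin m) :
    W.A a b * W.X c s = W.X c s * W.A a b + if b = s then W.X c a else 0 := by
  have h : ∀ t, W.A a b * (W.A s t * W.D t) = W.A s t * W.D t * W.A a b +
      (if b = t then W.A s t * W.D a else 0) + (if b = s then W.A a t * W.D t else 0) -
      (if t = a then W.A s b * W.D t else 0) := by
    intro t
    rw [← mul_assoc, W.A_mul_A, sub_mul, add_mul, mul_assoc, W.A_mul_D, mul_add, ← mul_assoc]
    split_ifs <;> simp
  have h1 : W.A a b * ∑ t, W.A s t * W.D t = (∑ t, W.A s t * W.D t) * W.A a b +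
      if b = s then ∑ t, W.A a t * W.D t else 0 := by
    rw [Finset.mul_sum, Finset.sum_congr rfl fun t _ => h t]
    simp only [Finset.sum_sub_distrib, Finset.sum_add_distrib, Finset.sum_ite_eq,
      Finset.sum_ite_eq', Finset.mem_univ, if_true, Finset.sum_mul]
    split_ifs <;> (try simp) <;> abel
  have h2 : W.A a b * (algebraMap ℂ B c * W.D s) = algebraMap ℂ B c * W.D s * W.A a b +
      if b = s then algebraMap ℂ B c * W.D a else 0 := by
    rw [← mul_assoc, ← Algebra.commutes, mul_assoc, W.A_mul_D, mul_add, mul_assoc]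
    split_ifs <;> simp
  simp only [X]
  rw [mul_sub, h1, h2, sub_mul]
  split_ifs <;> (try simp) <;> abel

theorem X_mul_D (s t : Fin m) : W.X c s * W.D t = W.D t * W.X c s + W.D s * W.D t := by
  have h : ∀ r, W.A s r * W.D r * W.D t = W.D t * (W.A s r * W.D r) +
      if r = t then W.D s * W.D r else 0 := by
    intro r
    rw [mul_assoc, W.D_mul_D r t, ← mul_assoc, W.A_mul_D, add_mul, mul_assoc]
    split_ifs <;> simp
  simp only [X]
  rw [sub_mul, Finset.sum_mul, Finset.sum_congr rfl fun r _ => h r, Finset.sum_add_distrib,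
    mul_sub, Finset.mul_sum, ← mul_assoc, ← Algebra.commutes, mul_assoc, mul_assoc,
    ← W.D_mul_D s t]
  simp
  abel

/-- Moving X_s past A_rt and D_t leaves (Σ_t A_rt D_t - X_r) D_s = c D_r D_s, which cancels against
the error produced by the term -c D_r of X_r. -/
theorem X_mul_X (s r : Fin m) : W.X c s * W.X c r = W.X c r * W.X c s := by
  have h : ∀ t, W.X c s * (W.A r t * W.D t) = W.A r t * W.D t * W.X c s +
      W.A r t * W.D t * W.D s - if t = s then W.X c r * W.D t else 0 := by
    intro t
    have h1 := W.A_mul_X c r t s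
    have h2 := W.X_mul_D c s t
    replace h1 := eq_sub_of_add_eq h1.symm
    rw [← mul_assoc, h1, sub_mul, mul_assoc, h2, W.D_mul_D s t, mul_add, ← mul_assoc,
      ← mul_assoc]
    split_ifs <;> simp
  conv_lhs => enter [2]; rw [X]
  rw [mul_sub, Finset.mul_sum, Finset.sum_congr rfl fun t _ => h t, Finset.sum_sub_distrib,
    Finset.sum_add_distrib, Finset.sum_ite_eq', ← mul_assoc, ← Algebra.commutes, mul_assoc,
    W.X_mul_D c s r, W.D_mul_D s r, ← Finset.sum_mul, ← Finset.sum_mul, mul_add, ← mul_assoc,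
    ← mul_assoc]
  conv_rhs => rw [X.eq_1 W c r, sub_mul]
  simp only [Finset.mem_univ, if_true]
  conv_lhs => enter [1, 2]; rw [X.eq_1 W c r, sub_mul]
  abel

theorem Z_mul_Y (t : Fin m) : W.Z c * W.Y t = W.Y t * W.Z c + W.Y t := by
  have h : ∀ r, W.Y r * W.D r * W.Y t = W.Y t * (W.Y r * W.D r) +
      if r = t then W.Y r else 0 := by
    intro r
    rw [mul_assoc, W.D_mul_Y, mul_add, ← mul_assoc, W.Y_mul_Y r t, mul_assoc]
    split_ifs <;> simp
  simp only [Z]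
  rw [add_mul, mul_add, Finset.sum_mul, Finset.sum_congr rfl fun r _ => h r,
    Finset.sum_add_distrib, Finset.mul_sum, Algebra.commutes]
  simp
  abel

theorem Z_mul_D (t : Fin m) : W.Z c * W.D t = W.D t * W.Z c - W.D t := by
  have h : ∀ r, W.Y r * W.D r * W.D t = W.D t * (W.Y r * W.D r) -
      if t = r then W.D r else 0 := by
    intro r
    rw [mul_assoc, W.D_mul_D r t, ← mul_assoc, ← mul_assoc, W.D_mul_Y t r, add_mul]
    split_ifs <;> simp
  simp only [Z]
  rw [add_mul, mul_add, Finset.sum_mul, Finset.sum_congr rfl fun r _ => h r,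
    Finset.sum_sub_distrib, Finset.mul_sum, Algebra.commutes]
  simp
  abel

theorem A_mul_Z (s t : Fin m) : W.A s t * W.Z c = W.Z c * W.A s t := by
  have h : ∀ r, W.A s t * (W.Y r * W.D r) = W.Y r * W.D r * W.A s t +
      (if t = r then W.Y r * W.D s else 0) - if s = r then W.Y t * W.D r else 0 := by
    intro r
    rw [← mul_assoc, W.A_mul_Y, sub_mul, mul_assoc, W.A_mul_D, mul_add, ← mul_assoc]
    split_ifs <;> simp
  simp only [Z]
  rw [add_mul, mul_add, Finset.mul_sum, Finset.sum_congr rfl fun r _ => h r,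
    Finset.sum_sub_distrib, Finset.sum_add_distrib, Finset.sum_mul, Algebra.commutes]
  simp

/-- Moving D_r past Y_t yields A_st, and moving A_sr past Y_t yields the Euler operator inside Z;
the summand -c D_s of X supplies the constant of Z. -/
theorem X_mul_Y (s t : Fin m) :
    W.X c s * W.Y t = W.Y t * W.X c s + W.A s t - if s = t then W.Z c else 0 := by
  have h : ∀ r, W.A s r * W.D r * W.Y t = W.Y t * (W.A s r * W.D r) -
      (if s = t then W.Y r * W.D r else 0) + if r = t then W.A s r else 0 := by
    intro r
    rw [mul_assoc, W.D_mul_Y, mul_add, ← mul_assoc, W.A_mul_Y, sub_mul, mul_assoc]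
    split_ifs <;> simp
  simp only [X, Z]
  rw [sub_mul, Finset.sum_mul, Finset.sum_congr rfl fun r _ => h r, mul_sub, Finset.mul_sum,
    Finset.sum_add_distrib, Finset.sum_sub_distrib, mul_assoc, W.D_mul_Y, mul_add, ← mul_assoc,
    ← mul_assoc, Algebra.commutes c (W.Y t)]
  split_ifs <;> (try simp) <;> abel

theorem X_mul_Z (s : Fin m) : W.X c s * W.Z c = W.Z c * W.X c s + W.X c s := by
  have h : ∀ t, W.A s t * W.D t * W.Z c = W.Z c * (W.A s t * W.D t) + W.A s t * W.D t := by
    intro t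
    have := W.Z_mul_D c t
    rw [eq_sub_iff_add_eq] at this
    rw [mul_assoc, ← this, mul_add, ← mul_assoc, W.A_mul_Z, mul_assoc]
  have h' := W.Z_mul_D c s
  rw [eq_sub_iff_add_eq] at h'
  conv_lhs => rw [X, sub_mul, Finset.sum_mul, Finset.sum_congr rfl fun t _ => h t, mul_assoc, ← h',
    Finset.sum_add_distrib, mul_add, ← mul_assoc, Algebra.commutes, mul_assoc, ← Finset.mul_sum]
  simp only [X, mul_sub]
  abel

/-- The operators of the matrix units of `gl(m+1)`. -/
def op (i j : Fin (m + 1)) : B :=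
  Fin.lastCases (Fin.lastCases (W.Z c) W.Y j) (fun s => Fin.lastCases (W.X c s) (W.A s) j) i

@[simp] theorem op_castSucc_castSucc (s t : Fin m) : W.op c s.castSucc t.castSucc = W.A s t := by
  simp [op]

@[simp] theorem op_castSucc_last (s : Fin m) : W.op c s.castSucc (Fin.last m) = W.X c s := by
  simp [op]

@[simp] theorem op_last_castSucc (t : Fin m) : W.op c (Fin.last m) t.castSucc = W.Y t := by
  simp [op]

@[simp] theorem op_last_last : W.op c (Fin.last m) (Fin.last m) = W.Z c := by
  simp [op]

/-- Each index is last or not, which makes sixteen cases; the relations above cover them, some read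
from right to left. -/
theorem op_mul_op (i j k l : Fin (m + 1)) : W.op c i j * W.op c k l = W.op c k l * W.op c i j +
    (if j = k then W.op c i l else 0) - if l = i then W.op c k j else 0 := by
  cases i using Fin.lastCases <;> cases j using Fin.lastCases <;>
    cases k using Fin.lastCases <;> cases l using Fin.lastCases <;>
    simp only [op_castSucc_castSucc, op_castSucc_last, op_last_castSucc, op_last_last,
      Fin.castSucc_inj, Fin.castSucc_ne_last, (Fin.castSucc_ne_last _).symm, if_true, if_false,
      add_zero, sub_zero]
  · abel
  · exact W.Z_mul_Y c _
  · rw [X_mul_Z, add_sub_cancel_right]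
  · exact (W.A_mul_Z c _ _).symm
  · rw [Z_mul_Y, add_sub_cancel_right]
  · exact W.Y_mul_Y _ _
  · rename_i t s
    simp only [X_mul_Y, eq_comm (a := t)]
    abel
  · rename_i r s t
    simp only [A_mul_Y, eq_comm (a := r)]
    abel
  · exact W.X_mul_Z c _
  · rename_i s t
    simp only [X_mul_Y, eq_comm (a := t)]
  · exact W.X_mul_X c _ _
  · rename_i r s t
    rw [A_mul_X]
    abel
  · exact W.A_mul_Z c _ _
  · rename_i a b r
    simp only [A_mul_Y, eq_comm (a := r)]
  · exact W.A_mul_X c _ _ _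
  · exact W.A_mul_A _ _ _ _

end WeylGl

/-! ### The polynomial model -/

section TensorModel

open MvPolynomial

variable {m : ℕ} {V : Type} [AddCommGroup V] [Module ℂ V]

/-- The space `ℂ[y₁, …, y_m] ⊗ V` that carries the generalized Verma module. -/
abbrev PolyTensor (m : ℕ) (V : Type) [AddCommGroup V] [Module ℂ V] : Type :=
  MvPolynomial (Fin m) ℂ ⊗[ℂ] V

/-- The commutator of two derivations is a derivation, and this one vanishes on the variables. -/
theorem pderiv_pderiv_comm (s t : Fin m) (p : MvPolynomial (Fin m) ℂ) :
    pderiv s (pderiv t p) = pderiv t (pderiv s p) := by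
  have h : ⁅(pderiv s : Derivation ℂ (MvPolynomial (Fin m) ℂ) (MvPolynomial (Fin m) ℂ)),
      (pderiv t : Derivation ℂ (MvPolynomial (Fin m) ℂ) (MvPolynomial (Fin m) ℂ))⁆ = 0 := by
    refine derivation_ext fun i => ?_
    rw [Derivation.commutator_apply, Derivation.zero_apply, pderiv_X, pderiv_X, Pi.single_apply,
      Pi.single_apply]
    split_ifs <;> simp
  have := DFunLike.congr_fun h p
  rwa [Derivation.commutator_apply, Derivation.zero_apply, sub_eq_zero] at this

/-- The coefficient of a monomial, as a map `ℂ[y₁, …, y_m] ⊗ V → V`. -/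
noncomputable def coeffTensor (d : Fin m →₀ ℕ) : PolyTensor m V →ₗ[ℂ] V :=
  (TensorProduct.lid ℂ V).toLinearMap ∘ₗ (lcoeff ℂ d).rTensor V

theorem coeffTensor_tmul (d : Fin m →₀ ℕ) (p : MvPolynomial (Fin m) ℂ) (v : V) :
    coeffTensor d (p ⊗ₜ v) = coeff d p • v := rfl

theorem eq_zero_of_coeffTensor {w : PolyTensor m V} (h : ∀ d, coeffTensor d w = 0) : w = 0 := by
  have key : ∀ w : PolyTensor m V, ∀ d,
      TensorProduct.equivFinsuppOfBasisLeft (basisMonomials (Fin m) ℂ) w d = coeffTensor d w := by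
    intro w d
    induction w using TensorProduct.induction_on with
    | zero => simp
    | tmul p v =>
      rw [TensorProduct.equivFinsuppOfBasisLeft_apply_tmul_apply, coeffTensor_tmul]
      rfl
    | add x y hx hy => rw [map_add, Finsupp.add_apply, hx, hy, map_add]
  refine (TensorProduct.equivFinsuppOfBasisLeft (basisMonomials (Fin m) ℂ)).map_eq_zero_iff.1 ?_
  ext d
  rw [key, h, Finsupp.zero_apply]

theorem one_tmul_injective (v : V) (h : (1 : MvPolynomial (Fin m) ℂ) ⊗ₜ[ℂ] v = 0) : v = 0 := by
  have := congrArg (coeffTensor 0) h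
  rwa [coeffTensor_tmul, coeff_zero_one, one_smul, map_zero] at this

/-- Multiplication by variables, partial derivatives and the operators of a representation of
`gl(m)` on `V`, all acting on `ℂ[y₁, …, y_m] ⊗ V`. -/
noncomputable def polyWeylGl (ρ : Gl m →ₗ⁅ℂ⁆ Module.End ℂ V) :
    WeylGl m (Module.End ℂ (PolyTensor m V)) where
  Y t := (LinearMap.mulLeft ℂ (X t)).rTensor V
  D s := (pderiv s).toLinearMap.rTensor V
  E s t := (ρ (Matrix.single s t 1)).lTensor (MvPolynomial (Fin m) ℂ)
  Y_mul_Y s t := by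
    refine TensorProduct.ext' fun p v => ?_
    simp [mul_left_comm]
  D_mul_D s t := by
    refine TensorProduct.ext' fun p v => ?_
    change pderiv s (pderiv t p) ⊗ₜ v = pderiv t (pderiv s p) ⊗ₜ[ℂ] v
    rw [pderiv_pderiv_comm]
  D_mul_Y s t := by
    refine TensorProduct.ext' fun p v => ?_
    rcases eq_or_ne s t with rfl | h
    · simp [TensorProduct.add_tmul, add_comm]
    · simp [pderiv_X_of_ne h.symm, h]
  E_mul_Y s t r := by
    refine TensorProduct.ext' fun p v => ?_
    simp
  E_mul_D s t r := by
    refine TensorProduct.ext' fun p v => ?_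
    simp
  E_mul_E i j k l := by
    have h := LieHom.map_lie ρ (Matrix.single i j 1) (Matrix.single k l 1)
    rw [LieRing.of_associative_ring_bracket, LieRing.of_associative_ring_bracket, map_sub] at h
    have h1 : ρ (Matrix.single i j 1 * Matrix.single k l 1) =
        if j = k then ρ (Matrix.single i l 1) else 0 := by
      split_ifs with hjk
      · subst hjk; rw [Matrix.single_mul_single_same, mul_one]
      · rw [Matrix.single_mul_single_of_ne _ _ _ _ hjk, map_zero]
    have h2 : ρ (Matrix.single k l 1 * Matrix.single i j 1) =
        if l = i then ρ (Matrix.single k j 1) else 0 := by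
      split_ifs with hli
      · subst hli; rw [Matrix.single_mul_single_same, mul_one]
      · rw [Matrix.single_mul_single_of_ne _ _ _ _ hli, map_zero]
    rw [h1, h2] at h
    refine TensorProduct.ext' fun p v => ?_
    have hv := DFunLike.congr_fun (sub_eq_iff_eq_add'.1 h.symm) v
    rw [Module.End.mul_apply, LinearMap.add_apply, Module.End.mul_apply] at hv
    have hE : ∀ i j (p : MvPolynomial (Fin m) ℂ) (v : V),
        (ρ (Matrix.single i j 1)).lTensor (MvPolynomial (Fin m) ℂ) (p ⊗ₜ v) =
          p ⊗ₜ ρ (Matrix.single i j 1) v := fun _ _ _ _ => rfl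
    have hite : ∀ (q : Prop) [Decidable q] (f g : Module.End ℂ (PolyTensor m V)) x,
        (if q then f else g) x = if q then f x else g x := fun q _ f g x => by split_ifs <;> rfl
    rw [Module.End.mul_apply, hE, hE, hv, TensorProduct.tmul_add, LinearMap.sub_apply,
      TensorProduct.tmul_sub, ← add_sub_assoc]
    refine congrArg₂ _ (congrArg₂ _ rfl ?_) ?_
    · rw [hite]
      split_ifs <;> simp
    · rw [hite]
      split_ifs <;> simp

/-- The representation of `gl(m+1)` on `ℂ[y₁, …, y_m] ⊗ V` in which the last diagonal matrix unit
acts on `V` by `c`. -/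
noncomputable def polyRep (ρ : Gl m →ₗ⁅ℂ⁆ Module.End ℂ V) (c : ℂ) :
    Gl (m + 1) →ₗ⁅ℂ⁆ Module.End ℂ (PolyTensor m V) :=
  matrixLieHom ((polyWeylGl ρ).op c) ((polyWeylGl ρ).op_mul_op c)

variable (ρ : Gl m →ₗ⁅ℂ⁆ Module.End ℂ V) (c : ℂ)

theorem polyWeylGl_Y_tmul (t : Fin m) (p : MvPolynomial (Fin m) ℂ) (v : V) :
    (polyWeylGl ρ).Y t (p ⊗ₜ v) = (X t * p) ⊗ₜ v := rfl

theorem polyWeylGl_D_tmul (t : Fin m) (p : MvPolynomial (Fin m) ℂ) (v : V) :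
    (polyWeylGl ρ).D t (p ⊗ₜ v) = pderiv t p ⊗ₜ v := rfl

theorem polyWeylGl_E_tmul (s t : Fin m) (p : MvPolynomial (Fin m) ℂ) (v : V) :
    (polyWeylGl ρ).E s t (p ⊗ₜ v) = p ⊗ₜ ρ (Matrix.single s t 1) v := rfl

theorem map_matrix_eq_sum {n M : Type} [Fintype n] [DecidableEq n] [AddCommGroup M] [Module ℂ M]
    (f : Matrix n n ℂ →ₗ[ℂ] M) (X : Matrix n n ℂ) :
    f X = ∑ i, ∑ j, X i j • f (Matrix.single i j 1) := by
  conv_lhs => rw [Matrix.matrix_eq_sum_single X]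
  simp only [map_sum]
  refine Finset.sum_congr rfl fun i _ => Finset.sum_congr rfl fun j _ => ?_
  rw [← map_smul, Matrix.smul_single, smul_eq_mul, mul_one]

/-- Derivatives kill constants, so on 1 ⊗ v the last column acts by zero and the upper left block
only through `ρ`. This makes v ↦ 1 ⊗ v suitable for Frobenius reciprocity. -/
theorem polyRep_one_tmul (M : Gl (m + 1)) (v : V) :
    polyRep ρ c M (1 ⊗ₜ v) =
      1 ⊗ₜ ρ (Matrix.of fun i j : Fin m => M i.castSucc j.castSucc) v +
        ∑ t, M (Fin.last m) t.castSucc • (X t : MvPolynomial (Fin m) ℂ) ⊗ₜ[ℂ] v +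
        (M (Fin.last m) (Fin.last m) * c) • 1 ⊗ₜ v := by
  have hD : ∀ t, (polyWeylGl ρ).D t (1 ⊗ₜ v) = 0 := fun t => by
    rw [polyWeylGl_D_tmul, pderiv_one, TensorProduct.zero_tmul]
  have hA : ∀ s t, (polyWeylGl ρ).A s t (1 ⊗ₜ v) = 1 ⊗ₜ ρ (Matrix.single s t 1) v := fun s t => by
    rw [WeylGl.A, LinearMap.sub_apply, Module.End.mul_apply, hD, map_zero, sub_zero,
      polyWeylGl_E_tmul]
  have hX : ∀ s, (polyWeylGl ρ).X c s (1 ⊗ₜ v) = 0 := fun s => by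
    simp [WeylGl.X, hD]
  have hZ : (polyWeylGl ρ).Z c (1 ⊗ₜ v) = c • 1 ⊗ₜ v := by
    simp [WeylGl.Z, hD, Algebra.algebraMap_eq_smul_one]
  have hY : ∀ t, (polyWeylGl ρ).Y t (1 ⊗ₜ v) = X t ⊗ₜ v := fun t => by
    rw [polyWeylGl_Y_tmul, mul_one]
  have h := map_matrix_eq_sum (ρ : Gl m →ₗ[ℂ] Module.End ℂ V)
    (Matrix.of fun i j : Fin m => M i.castSucc j.castSucc)
  change ρ _ = ∑ i, ∑ j, _ • ρ _ at h
  rw [h, polyRep, matrixLieHom_apply]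
  simp only [LinearMap.sum_apply, LinearMap.add_apply, LinearMap.smul_apply, Fin.sum_univ_castSucc,
    WeylGl.op_castSucc_castSucc, WeylGl.op_castSucc_last, WeylGl.op_last_castSucc,
    WeylGl.op_last_last, hA, hX, hZ, hY, smul_zero, add_zero, TensorProduct.tmul_sum,
    TensorProduct.tmul_smul, Matrix.of_apply, smul_smul, add_assoc]

theorem polyRep_single (i j : Fin (m + 1)) :
    polyRep ρ c (Matrix.single i j 1) = (polyWeylGl ρ).op c i j :=
  matrixLieHom_single _ _ i j

end TensorModel

/-- For every weight there is a representation of `gl(m)` with a highest weight vector of that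
weight. -/
theorem exists_highestWeight_rep (m : ℕ) (μ : Fin m → ℂ) :
    ∃ (V : Type) (_ : AddCommGroup V) (_ : Module ℂ V) (ρ : Gl m →ₗ⁅ℂ⁆ Module.End ℂ V) (v : V),
      v ≠ 0 ∧ ∀ M ∈ borelGl m, ρ M v = (∑ i, μ i * M i i) • v := by
  induction m with
  | zero => exact ⟨ℂ, inferInstance, inferInstance, 0, 1, one_ne_zero, fun M _ => by simp⟩
  | succ m ih =>
    obtain ⟨V, _, _, ρ, v, hv, h⟩ := ih fun i => μ i.castSucc
    -- The free parameter of the model is the last weight coordinate; 1 ⊗ v then has the required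
    -- weight.
    refine ⟨PolyTensor m V, inferInstance, inferInstance, polyRep ρ (μ (Fin.last m)), 1 ⊗ₜ v, ?_,
      fun M hM => ?_⟩
    · exact fun h0 => hv (one_tmul_injective v h0)
    · have hz : ∑ t : Fin m, M (Fin.last m) t.castSucc •
          (MvPolynomial.X t : MvPolynomial (Fin m) ℂ) ⊗ₜ[ℂ] v = 0 :=
        Finset.sum_eq_zero fun t _ => by rw [hM _ _ (Fin.castSucc_lt_last t), zero_smul]
      rw [polyRep_one_tmul, h (Matrix.of fun i j : Fin m => M i.castSucc j.castSucc)
          fun i j hij => hM _ _ (Fin.castSucc_lt_castSucc_iff.2 hij), hz,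
        Fin.sum_univ_castSucc, TensorProduct.tmul_smul, add_zero, ← add_smul, mul_comm (M _ _)]
      rfl

/-! ### Highest weight modules and their grading -/

section HighestWeight

variable {m : ℕ} {W : Type} [AddCommGroup W] [Module ℂ W] [LieRingModule (Gl m) W]
  [LieModule ℂ (Gl m) W]

/-- The vector `v` is a highest weight vector of weight `μ` and generates the module. -/
structure IsHighestWeightGenerator (μ : Fin m → ℂ) (v : W) : Prop where
  lie_eq : ∀ M ∈ borelGl m, ⁅M, v⁆ = (∑ i, μ i * M i i) • v
  eq_top : ∀ N : LieSubmodule ℂ (Gl m) W, v ∈ N → N = ⊤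

theorem lie_mem_of_forall_single {S : Submodule ℂ W} {x : W}
    (h : ∀ i j : Fin m, ⁅(Matrix.single i j 1 : Gl m), x⁆ ∈ S) (M : Gl m) : ⁅M, x⁆ ∈ S := by
  have key := map_matrix_eq_sum (((LieModule.toEnd ℂ (Gl m) W : Gl m →ₗ[ℂ] Module.End ℂ W)).flip x) M
  change ⁅M, x⁆ = ∑ i, ∑ j, M i j • ⁅(Matrix.single i j 1 : Gl m), x⁆ at key
  rw [key]
  exact S.sum_mem fun i _ => S.sum_mem fun j _ => S.smul_mem _ (h i j)

/-- A highest weight module is spanned by what the lower triangular matrix units produce from a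
generator. -/
theorem IsHighestWeightGenerator.eq_top_of_lower {μ : Fin m → ℂ} {v : W}
    (hv : IsHighestWeightGenerator μ v) {S : Submodule ℂ W} (hvS : v ∈ S)
    (hS : ∀ i j : Fin m, j < i → ∀ w ∈ S, ⁅(Matrix.single i j 1 : Gl m), w⁆ ∈ S) : S = ⊤ := by
  let 𝒮 : Set (Submodule ℂ W) := {S | v ∈ S ∧
    ∀ i j : Fin m, j < i → ∀ w ∈ S, ⁅(Matrix.single i j 1 : Gl m), w⁆ ∈ S}
  have hv₀ : v ∈ sInf 𝒮 := Submodule.mem_sInf.2 fun S hS => hS.1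
  have hlow : ∀ i j : Fin m, j < i → ∀ w ∈ sInf 𝒮, ⁅(Matrix.single i j 1 : Gl m), w⁆ ∈ sInf 𝒮 :=
    fun i j hij w hw => Submodule.mem_sInf.2 fun S hS =>
      hS.2 i j hij w (Submodule.mem_sInf.1 hw S hS)
  -- By the Leibniz rule, the vectors that all of gl(m) keeps inside the smallest lower-stable
  -- subspace containing `v` are again lower-stable. By minimality they exhaust that subspace, which
  -- is thus a submodule.
  let T : Submodule ℂ W :=
    { carrier := {x | x ∈ sInf 𝒮 ∧ ∀ M : Gl m, ⁅M, x⁆ ∈ sInf 𝒮}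
      add_mem' := fun {a b} ha hb => ⟨add_mem ha.1 hb.1, fun M => by
        rw [lie_add]; exact add_mem (ha.2 M) (hb.2 M)⟩
      zero_mem' := ⟨zero_mem _, fun M => by rw [lie_zero]; exact zero_mem _⟩
      smul_mem' := fun c a ha => ⟨Submodule.smul_mem _ c ha.1, fun M => by
        rw [lie_smul]; exact Submodule.smul_mem _ c (ha.2 M)⟩ }
  have hT : T ∈ 𝒮 := by
    refine ⟨⟨hv₀, lie_mem_of_forall_single fun i j => ?_⟩, fun i j hij w hw =>
      ⟨hlow i j hij w hw.1, fun M => ?_⟩⟩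
    · rcases lt_or_ge j i with hij | hij
      · exact hlow i j hij v hv₀
      · rw [hv.lie_eq]
        · exact Submodule.smul_mem _ _ hv₀
        · intro k l hkl
          rw [Matrix.single_apply, if_neg]
          rintro ⟨rfl, rfl⟩
          exact absurd hij (not_le.2 hkl)
    · rw [leibniz_lie]
      exact add_mem (hw.2 _) (hlow i j hij _ (hw.2 M))
  have hle : sInf 𝒮 ≤ T := sInf_le hT
  have htop := hv.eq_top { sInf 𝒮 with lie_mem := fun {M x} hx => (hle hx).2 M } hv₀
  have hSmem : S ∈ 𝒮 := ⟨hvS, hS⟩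
  refine eq_top_iff.2 (le_trans (fun w _ => ?_) (sInf_le hSmem))
  have hw : w ∈ (⊤ : LieSubmodule ℂ (Gl m) W) := trivial
  rwa [← htop] at hw

/-- A diagonal matrix whose adjoint action distinguishes strictly lower triangular matrices. -/
noncomputable def gradingElement (m : ℕ) : Gl m := Matrix.diagonal fun i => -(i : ℂ)

theorem lie_gradingElement_single (i j : Fin m) :
    ⁅gradingElement m, (Matrix.single i j 1 : Gl m)⁆ =
      ((j : ℂ) - (i : ℂ)) • (Matrix.single i j 1 : Gl m) := by
  rw [LieRing.of_associative_ring_bracket]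
  ext a b
  rw [gradingElement, Matrix.sub_apply, Matrix.diagonal_mul, Matrix.mul_diagonal, Matrix.smul_apply,
    Matrix.single_apply]
  split_ifs with h
  · rw [h.1, h.2, smul_eq_mul]; ring
  · simp

/-- The value of a weight at the grading element. -/
noncomputable def gradingValue (μ : Fin m → ℂ) : ℂ := ∑ i, μ i * gradingElement m i i

/-- The sum of the eigenspaces of the grading element strictly below the highest weight. -/
noncomputable def lowerPart (μ : Fin m → ℂ) (W : Type) [AddCommGroup W] [Module ℂ W]
    [LieRingModule (Gl m) W] [LieModule ℂ (Gl m) W] : Submodule ℂ W :=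
  ⨆ n : ℕ, (LieModule.toEnd ℂ (Gl m) W (gradingElement m)).eigenspace (gradingValue μ - (n + 1))

theorem lie_single_mem_eigenspace {i j : Fin m} {a : ℂ} {w : W}
    (hw : w ∈ (LieModule.toEnd ℂ (Gl m) W (gradingElement m)).eigenspace a) :
    ⁅(Matrix.single i j 1 : Gl m), w⁆ ∈
      (LieModule.toEnd ℂ (Gl m) W (gradingElement m)).eigenspace (a + (j - i)) := by
  rw [Module.End.mem_eigenspace_iff] at hw ⊢
  change ⁅gradingElement m, w⁆ = _ at hw
  change ⁅gradingElement m, ⁅(Matrix.single i j 1 : Gl m), w⁆⁆ = _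
  rw [leibniz_lie, hw, lie_gradingElement_single, smul_lie, lie_smul, ← add_smul, add_comm]

variable {μ : Fin m → ℂ} {v : W}

theorem IsHighestWeightGenerator.mem_eigenspace (hv : IsHighestWeightGenerator μ v) :
    v ∈ (LieModule.toEnd ℂ (Gl m) W (gradingElement m)).eigenspace (gradingValue μ) := by
  rw [Module.End.mem_eigenspace_iff]
  exact hv.lie_eq _ fun i j hij => Matrix.diagonal_apply_ne _ hij.ne'

/-- A strictly lower matrix unit lowers the eigenvalue of the grading element by a positive integer,
so the sum is lower-stable. -/
theorem IsHighestWeightGenerator.span_sup_lowerPart (hv : IsHighestWeightGenerator μ v) :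
    Submodule.span ℂ {v} ⊔ lowerPart μ W = ⊤ := by
  have key : ∀ (n : ℕ) (i j : Fin m), j < i → ∀ w ∈
      (LieModule.toEnd ℂ (Gl m) W (gradingElement m)).eigenspace (gradingValue μ - n),
      ⁅(Matrix.single i j 1 : Gl m), w⁆ ∈ lowerPart μ W := by
    intro n i j hij w hw
    obtain ⟨k, hk⟩ := Nat.exists_eq_add_of_lt hij
    -- Here i = j + k + 1, so the eigenvalue falls by k + 1; summand number n + k belongs to the
    -- drop n + k + 1.
    refine Submodule.mem_iSup_of_mem (n + k) ?_
    convert lie_single_mem_eigenspace (i := i) (j := j) hw using 2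
    rw [hk]
    push_cast
    ring
  refine hv.eq_top_of_lower (Submodule.mem_sup_left (Submodule.mem_span_singleton_self v)) ?_
  intro i j hij w hw
  refine Submodule.mem_sup_right ?_
  obtain ⟨x, hx, k, hk, rfl⟩ := Submodule.mem_sup.1 hw
  obtain ⟨c, rfl⟩ := Submodule.mem_span_singleton.1 hx
  rw [lie_add, lie_smul]
  refine add_mem (Submodule.smul_mem _ c (key 0 i j hij v ?_)) ?_
  · simpa using hv.mem_eigenspace
  · clear hw
    induction hk using Submodule.iSup_induction' with
    | mem n x hx => exact key (n + 1) i j hij x (by exact_mod_cast hx)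
    | zero => rw [lie_zero]; exact zero_mem _
    | add x y _ _ hx hy => rw [lie_add]; exact add_mem hx hy

/-- A vector of the lower part involves finitely many eigenvalues, all different from the top one;
`q` is the product of the corresponding linear factors. It serves to isolate the top component. -/
theorem exists_aeval_eq_zero_of_mem_lowerPart {k : W} (hk : k ∈ lowerPart μ W) :
    ∃ q : Polynomial ℂ,
      Polynomial.aeval (LieModule.toEnd ℂ (Gl m) W (gradingElement m)) q k = 0 ∧
        q.eval (gradingValue μ) ≠ 0 := by
  induction hk using Submodule.iSup_induction' with
  | mem n x hx =>
    refine ⟨Polynomial.X - Polynomial.C (gradingValue μ - (n + 1)), ?_, ?_⟩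
    · rw [Module.End.mem_eigenspace_iff] at hx
      rw [map_sub, Polynomial.aeval_X, Polynomial.aeval_C, LinearMap.sub_apply, hx,
        Module.algebraMap_end_apply, sub_self]
    · rw [Polynomial.eval_sub, Polynomial.eval_X, Polynomial.eval_C, sub_sub_cancel]
      exact Nat.cast_add_one_ne_zero n
  | zero => exact ⟨1, map_zero _, by simp⟩
  | add x y _ _ hx hy =>
    obtain ⟨p, hp, hp'⟩ := hx
    obtain ⟨q, hq, hq'⟩ := hy
    refine ⟨p * q, ?_, ?_⟩
    · have hx0 : Polynomial.aeval (LieModule.toEnd ℂ (Gl m) W (gradingElement m)) (p * q) x = 0 := by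
        rw [mul_comm, map_mul, Module.End.mul_apply, hp, map_zero]
      rw [map_add, hx0, zero_add, map_mul, Module.End.mul_apply, hq, map_zero]
    · rw [Polynomial.eval_mul]
      exact mul_ne_zero hp' hq'

theorem aeval_toEnd_mem (N : LieSubmodule ℂ (Gl m) W) (M : Gl m) (q : Polynomial ℂ) {w : W}
    (hw : w ∈ N) : Polynomial.aeval (LieModule.toEnd ℂ (Gl m) W M) q w ∈ N := by
  induction q using Polynomial.induction_on' generalizing w with
  | add p q hp hq => rw [map_add]; exact N.add_mem (hp hw) (hq hw)
  | monomial n a =>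
    rw [Polynomial.aeval_monomial, Module.End.mul_apply, Module.algebraMap_end_apply]
    refine N.smul_mem a ?_
    induction n with
    | zero => exact hw
    | succ n ih => rw [pow_succ', Module.End.mul_apply]; exact N.lie_mem ih

theorem IsHighestWeightGenerator.aeval_apply (hv : IsHighestWeightGenerator μ v) (h0 : v ≠ 0)
    (q : Polynomial ℂ) :
    Polynomial.aeval (LieModule.toEnd ℂ (Gl m) W (gradingElement m)) q v =
      q.eval (gradingValue μ) • v :=
  Module.End.aeval_apply_of_hasEigenvector ⟨hv.mem_eigenspace, h0⟩

theorem IsHighestWeightGenerator.notMem_lowerPart (hv : IsHighestWeightGenerator μ v)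
    (h0 : v ≠ 0) : v ∉ lowerPart μ W := by
  intro h
  obtain ⟨q, hq, hq'⟩ := exists_aeval_eq_zero_of_mem_lowerPart h
  rw [hv.aeval_apply h0] at hq
  exact (smul_ne_zero hq' h0) hq

/-- If c v + k lies in N with c ≠ 0, a polynomial in the grading element kills k and rescales v by a
nonzero factor, so N contains the generator. This bound does not depend on N, hence survives sums of
proper submodules. -/
theorem IsHighestWeightGenerator.le_lowerPart (hv : IsHighestWeightGenerator μ v) (h0 : v ≠ 0)
    {N : LieSubmodule ℂ (Gl m) W} (hN : N ≠ ⊤) : (N : Submodule ℂ W) ≤ lowerPart μ W := by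
  intro w hw
  have hw' : w ∈ Submodule.span ℂ {v} ⊔ lowerPart μ W := by
    rw [hv.span_sup_lowerPart]; trivial
  obtain ⟨x, hx, k, hk, rfl⟩ := Submodule.mem_sup.1 hw'
  obtain ⟨c, rfl⟩ := Submodule.mem_span_singleton.1 hx
  rcases eq_or_ne c 0 with rfl | hc
  · rwa [zero_smul, zero_add]
  · obtain ⟨q, hq, hq'⟩ := exists_aeval_eq_zero_of_mem_lowerPart hk
    have := aeval_toEnd_mem N (gradingElement m) q hw
    rw [map_add, hq, add_zero, map_smul, hv.aeval_apply h0, smul_smul] at this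
    exact absurd (hv.eq_top N ((Submodule.smul_mem_iff (N : Submodule ℂ W)
      (mul_ne_zero hc hq')).1 this)) hN

end HighestWeight

/-! ### Verma modules and their simple quotients -/

namespace Verma

variable (m : ℕ) (μ : Fin m → ℂ)

/-- The generator of the Verma module. -/
noncomputable def generator : Verma m μ := Ind.of (borelGl m) (borelRep m μ) 1

theorem isHighestWeightGenerator : IsHighestWeightGenerator μ (generator m μ) where
  lie_eq M hM := by
    have := Ind.lie_of (borelGl m) (borelRep m μ) ⟨M, hM⟩ 1
    refine this.trans ?_
    rw [generator, ← map_smul]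
    rfl
  eq_top N hN := Ind.eq_top_of_forall_of_mem fun c => by
    have := N.smul_mem c hN
    rwa [generator, ← map_smul, smul_eq_mul, mul_one] at this

/-- Frobenius reciprocity maps the generator to the nonzero highest weight vector of a concrete
representation. -/
theorem generator_ne_zero : generator m μ ≠ 0 := by
  obtain ⟨V, _, _, ρ, v, hv, h⟩ := exists_highestWeight_rep m μ
  obtain ⟨g, -, hg⟩ := Ind.exists_lift (P := borelGl m) (ρ := borelRep m μ) ρ
    (LinearMap.toSpanSingleton ℂ V v) fun x c => by
      rw [LinearMap.toSpanSingleton_apply, LinearMap.toSpanSingleton_apply, map_smul, h _ x.2,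
        smul_smul, mul_comm]
      rfl
  intro h0
  have := hg 1
  rw [← generator, h0, map_zero, LinearMap.toSpanSingleton_apply, one_smul] at this
  exact hv this.symm

theorem radical_ne_top : radical m μ ≠ ⊤ := by
  have hv := isHighestWeightGenerator m μ
  have h0 := generator_ne_zero m μ
  intro h
  refine hv.notMem_lowerPart h0 ?_
  have hle : (radical m μ : Submodule ℂ (Verma m μ)) ≤ lowerPart μ (Verma m μ) := by
    rw [radical, LieSubmodule.sSup_toSubmodule]
    refine sSup_le ?_
    rintro _ ⟨N, hN, rfl⟩
    exact hv.le_lowerPart h0 hN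
  refine hle ?_
  rw [h]
  trivial

end Verma

namespace SimpleHW

variable (m : ℕ) (μ : Fin m → ℂ)

instance isIrreducible : LieModule.IsIrreducible ℂ (Gl m) (SimpleHW m μ) := by
  have : Nontrivial (SimpleHW m μ) := by
    refine Submodule.Quotient.nontrivial_iff.2 fun h => Verma.radical_ne_top m μ ?_
    exact LieSubmodule.toSubmodule_injective h
  refine LieModule.IsIrreducible.mk fun N hN => ?_
  by_contra hN'
  refine hN (eq_bot_iff.2 fun x hx => ?_)
  obtain ⟨y, rfl⟩ := LieSubmodule.Quotient.surjective_mk' (Verma.radical m μ) x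
  have hle : N.comap (LieSubmodule.Quotient.mk' (Verma.radical m μ)) ≤ Verma.radical m μ := by
    refine le_sSup fun h => hN' (eq_top_iff.2 fun z _ => ?_)
    obtain ⟨w, rfl⟩ := LieSubmodule.Quotient.surjective_mk' (Verma.radical m μ) z
    have : w ∈ N.comap (LieSubmodule.Quotient.mk' (Verma.radical m μ)) := by rw [h]; trivial
    exact this
  exact (LieSubmodule.mem_bot _).2 ((LieSubmodule.Quotient.mk_eq_zero' ).2 (hle hx))

theorem isHighestWeightGenerator :
    IsHighestWeightGenerator μ
      (LieSubmodule.Quotient.mk' (Verma.radical m μ) (Verma.generator m μ)) where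
  lie_eq M hM := by
    rw [← LieModuleHom.map_lie, (Verma.isHighestWeightGenerator m μ).lie_eq M hM, map_smul]
  eq_top N hN := by
    have := (Verma.isHighestWeightGenerator m μ).eq_top
      (N.comap (LieSubmodule.Quotient.mk' (Verma.radical m μ))) hN
    refine eq_top_iff.2 fun z _ => ?_
    obtain ⟨w, rfl⟩ := LieSubmodule.Quotient.surjective_mk' (Verma.radical m μ) z
    have hw : w ∈ N.comap (LieSubmodule.Quotient.mk' (Verma.radical m μ)) := by rw [this]; trivial
    exact hw

end SimpleHW

/-! ### Eigenvalues of the matrix of matrix units -/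

section CharacteristicIdentity

variable {m : ℕ} {W : Type} [AddCommGroup W] [Module ℂ W] [LieRingModule (Gl m) W]
  [LieModule ℂ (Gl m) W]

/-- The matrix of matrix units, acting on column vectors with entries in a `gl(m)`-module. -/
noncomputable def unitMatrixAct (m : ℕ) (W : Type) [AddCommGroup W] [Module ℂ W]
    [LieRingModule (Gl m) W] [LieModule ℂ (Gl m) W] : (Fin m → W) →ₗ[ℂ] (Fin m → W) :=
  LinearMap.pi fun s => ∑ t, LieModule.toEnd ℂ (Gl m) W (Matrix.single s t 1) ∘ₗ LinearMap.proj t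

/-- The action of `gl(m)` on the tensor product of `W` with the dual of `ℂ^m`. -/
noncomputable def dualAct (M : Gl m) : (Fin m → W) →ₗ[ℂ] (Fin m → W) :=
  LinearMap.pi fun s => LieModule.toEnd ℂ (Gl m) W M ∘ₗ LinearMap.proj s -
    ∑ a, M a s • LinearMap.proj a

theorem unitMatrixAct_apply (w : Fin m → W) (s : Fin m) :
    unitMatrixAct m W w s = ∑ t, ⁅(Matrix.single s t 1 : Gl m), w t⁆ := by
  simp [unitMatrixAct]

theorem dualAct_apply (M : Gl m) (w : Fin m → W) (s : Fin m) :
    dualAct M w s = ⁅M, w s⁆ - ∑ a, M a s • w a := by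
  simp [dualAct]

theorem lie_single_eq_sum (M : Gl m) (s t : Fin m) :
    ⁅M, (Matrix.single s t 1 : Gl m)⁆ =
      ∑ a, M a s • (Matrix.single a t 1 : Gl m) - ∑ a, M t a • (Matrix.single s a 1 : Gl m) := by
  rw [LieRing.of_associative_ring_bracket]
  ext i j
  simp [Matrix.sub_apply, Matrix.mul_apply, Matrix.sum_apply, Matrix.single_apply, ite_and]

/-- The commutator of M with E_st transforms the two indices as a vector and a covector; summation
over t contracts one of them against the dual action on the entries. -/
theorem dualAct_unitMatrixAct (M : Gl m) (w : Fin m → W) :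
    dualAct M (unitMatrixAct m W w) = unitMatrixAct m W (dualAct M w) := by
  ext s
  have h : ∀ t, ⁅M, ⁅(Matrix.single s t 1 : Gl m), w t⁆⁆ =
      ∑ a, M a s • ⁅(Matrix.single a t 1 : Gl m), w t⁆ -
        ∑ a, M t a • ⁅(Matrix.single s a 1 : Gl m), w t⁆ +
        ⁅(Matrix.single s t 1 : Gl m), ⁅M, w t⁆⁆ := by
    intro t
    rw [leibniz_lie, lie_single_eq_sum, sub_lie, sum_lie, sum_lie]
    simp only [smul_lie]
  simp only [dualAct_apply, unitMatrixAct_apply, lie_sum, lie_sub, h, Finset.sum_add_distrib,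
    Finset.sum_sub_distrib, Finset.smul_sum, lie_smul]
  rw [Finset.sum_comm (f := fun t a => M a s • ⁅(Matrix.single a t 1 : Gl m), w t⁆),
    Finset.sum_comm (f := fun t a => M t a • ⁅(Matrix.single s a 1 : Gl m), w t⁆)]
  abel

theorem dualAct_single (M : Gl m) (j : Fin m) (x : W) :
    dualAct M (Pi.single j x) = Pi.single j ⁅M, x⁆ - ∑ s, M j s • Pi.single s x := by
  ext s
  have h1 : ⁅M, (Pi.single j x : Fin m → W) s⁆ = (Pi.single j ⁅M, x⁆ : Fin m → W) s :=
    by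
    rcases eq_or_ne s j with rfl | hs
    · rw [Pi.single_eq_same, Pi.single_eq_same]
    · rw [Pi.single_eq_of_ne hs, Pi.single_eq_of_ne hs, lie_zero]
  rw [dualAct_apply, Pi.sub_apply, h1]
  simp [Finset.sum_apply, Pi.single_apply, eq_comm]

/-- The `gl(m)`-submodule of the tensor product with the dual of `ℂ^m` that is generated by the
products of `v` with the dual basis vectors of index at least `k`. -/
noncomputable def dualFiltration (v : W) (k : ℕ) : Submodule ℂ (Fin m → W) :=
  sInf {S | (∀ j : Fin m, k ≤ j → Pi.single j v ∈ S) ∧ ∀ M : Gl m, ∀ w ∈ S, dualAct M w ∈ S}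

theorem single_mem_dualFiltration (v : W) {k : ℕ} {j : Fin m} (h : k ≤ j) :
    Pi.single j v ∈ dualFiltration v k :=
  Submodule.mem_sInf.2 fun _ hS => hS.1 j h

theorem dualAct_mem_dualFiltration {v : W} {k : ℕ} (M : Gl m) {w : Fin m → W}
    (hw : w ∈ dualFiltration v k) : dualAct M w ∈ dualFiltration v k :=
  Submodule.mem_sInf.2 fun S hS => hS.2 M w (Submodule.mem_sInf.1 hw S hS)

theorem dualFiltration_le {v : W} {k : ℕ} {S : Submodule ℂ (Fin m → W)}
    (h : ∀ j : Fin m, k ≤ j → Pi.single j v ∈ S) (h' : ∀ M : Gl m, ∀ w ∈ S, dualAct M w ∈ S) :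
    dualFiltration v k ≤ S :=
  sInf_le ⟨h, h'⟩

variable {μ : Fin m → ℂ} {v : W}

/-- The x for which every x ⊗ e_j^* belongs to the filtration step form a submodule of W, and it
contains the generator. -/
theorem IsHighestWeightGenerator.mem_dualFiltration_zero (hv : IsHighestWeightGenerator μ v)
    (w : Fin m → W) : w ∈ dualFiltration v 0 := by
  let N : LieSubmodule ℂ (Gl m) W :=
    { carrier := {x | ∀ j : Fin m, Pi.single j x ∈ dualFiltration v 0}
      add_mem' := fun {a b} ha hb j => by rw [Pi.single_add]; exact add_mem (ha j) (hb j)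
      zero_mem' := fun j => by rw [Pi.single_zero]; exact zero_mem _
      smul_mem' := fun c a ha j => by
        rw [Pi.single_smul]; exact Submodule.smul_mem _ c (ha j)
      lie_mem := fun {M x} hx j => by
        have h := dualAct_mem_dualFiltration M (hx j)
        rw [dualAct_single] at h
        have h2 : ∑ s, M j s • (Pi.single s x : Fin m → W) ∈ dualFiltration v 0 :=
          Submodule.sum_mem _ fun s _ => Submodule.smul_mem _ _ (hx s)
        have h3 := add_mem h h2
        rwa [sub_add_cancel] at h3 }
  have hN : N = ⊤ := hv.eq_top N fun j => single_mem_dualFiltration v (Nat.zero_le _)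
  rw [← Finset.univ_sum_single w]
  refine Submodule.sum_mem _ fun j _ => ?_
  have : w j ∈ N := by rw [hN]; trivial
  exact this j

theorem dualFiltration_eq_bot (v : W) : dualFiltration (m := m) v m = ⊥ :=
  le_bot_iff.1 (dualFiltration_le (fun j h => absurd j.2 (not_lt.2 h)) fun M w hw => by
    rw [(Submodule.mem_bot ℂ).1 hw, map_zero]; exact zero_mem _)

/-- E_sj v is 0 for s < j and μ_j v for s = j. For s > j, (E_sj v) ⊗ e_s^* = E_sj (v ⊗ e_s^*) + v ⊗
e_j^*, and these m - 1 - j indices account for the shift of the eigenvalue. -/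
theorem IsHighestWeightGenerator.unitMatrixAct_single (hv : IsHighestWeightGenerator μ v)
    (j : Fin m) : unitMatrixAct m W (Pi.single j v) =
      (μ j + (m - 1 - j)) • (Pi.single j v : Fin m → W) +
        ∑ s ∈ Finset.Ioi j, dualAct (Matrix.single s j 1) (Pi.single s v) := by
  have h1 : unitMatrixAct m W (Pi.single j v) =
      ∑ s, Pi.single s ⁅(Matrix.single s j 1 : Gl m), v⁆ := by
    ext s
    rw [unitMatrixAct_apply, Finset.sum_eq_single j (fun t _ ht => by
      rw [Pi.single_eq_of_ne ht, lie_zero]) (by simp), Pi.single_eq_same]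
    simp [Finset.sum_apply, Pi.single_apply]
  have hlow : ∀ s ∈ Finset.Iio j, (Pi.single s ⁅(Matrix.single s j 1 : Gl m), v⁆ : Fin m → W) = 0 := by
    intro s hs
    rw [Finset.mem_Iio] at hs
    rw [hv.lie_eq _ fun a b hab => ?_, Finset.sum_eq_zero fun i _ => ?_, zero_smul, Pi.single_zero]
    · rw [Matrix.single_apply, if_neg, mul_zero]
      rintro ⟨rfl, rfl⟩
      exact lt_irrefl _ hs
    · rw [Matrix.single_apply, if_neg]
      rintro ⟨rfl, rfl⟩
      exact lt_asymm hs hab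
  have hdiag : ⁅(Matrix.single j j 1 : Gl m), v⁆ = μ j • v := by
    rw [hv.lie_eq _ fun a b hab => ?_]
    · simp [Matrix.single_apply]
    · rw [Matrix.single_apply, if_neg]
      rintro ⟨rfl, rfl⟩
      exact lt_irrefl _ hab
  have hup : ∀ s ∈ Finset.Ioi j, (Pi.single s ⁅(Matrix.single s j 1 : Gl m), v⁆ : Fin m → W) =
      dualAct (Matrix.single s j 1) (Pi.single s v) + Pi.single j v := by
    intro s _
    rw [dualAct_single]
    simp [Matrix.single_apply, ite_smul]
  have huniv : (Finset.univ : Finset (Fin m)) = insert j (Finset.Iio j ∪ Finset.Ioi j) := by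
    ext s
    simp only [Finset.mem_univ, Finset.mem_insert, Finset.mem_union, Finset.mem_Iio,
      Finset.mem_Ioi, true_iff]
    exact (lt_trichotomy s j).elim (fun h => Or.inr (Or.inl h))
      fun h => h.elim Or.inl fun h => Or.inr (Or.inr h)
  rw [h1, huniv, Finset.sum_insert (by simp), Finset.sum_union
    (Finset.disjoint_left.2 fun s hs hs' => lt_asymm (Finset.mem_Iio.1 hs) (Finset.mem_Ioi.1 hs')),
    Finset.sum_eq_zero hlow, zero_add, Finset.sum_congr rfl hup, Finset.sum_add_distrib,
    Finset.sum_const, Fin.card_Ioi, hdiag, Pi.single_smul, add_smul, ← Nat.cast_smul_eq_nsmul ℂ,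
    Nat.cast_sub (by have := j.2; omega), Nat.cast_sub (by have := j.2; omega)]
  push_cast
  abel

/-- Since the matrix commutes with gl(m), checking the generators v ⊗ e_j^* is enough. Only j = k
needs the exact scalar; for j > k every term already lies in the next step. -/
theorem IsHighestWeightGenerator.sub_smul_mem_dualFiltration (hv : IsHighestWeightGenerator μ v)
    (k : Fin m) {w : Fin m → W} (hw : w ∈ dualFiltration v k) :
    unitMatrixAct m W w - (μ k + (m - 1 - k)) • w ∈ dualFiltration v (k + 1) := by
  let S : Submodule ℂ (Fin m → W) :=
    (dualFiltration v (k + 1)).comap (unitMatrixAct m W - (μ k + (m - 1 - k)) • LinearMap.id)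
  have hS : ∀ w, w ∈ S ↔
    unitMatrixAct m W w - (μ k + (m - 1 - k)) • w ∈ dualFiltration v (k + 1) := fun w => Iff.rfl
  refine (hS w).1 (dualFiltration_le (fun j hj => (hS _).2 ?_) (fun M w hw => (hS _).2 ?_) hw)
  · have hsum : ∑ s ∈ Finset.Ioi j, dualAct (Matrix.single s j 1) (Pi.single s v) ∈
        dualFiltration v ((k : ℕ) + 1) := Submodule.sum_mem _ fun s hs =>
      dualAct_mem_dualFiltration _ (single_mem_dualFiltration v
        (hj.trans_lt (Fin.lt_def.1 (Finset.mem_Ioi.1 hs))))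
    rw [hv.unitMatrixAct_single]
    rcases eq_or_lt_of_le hj with h | h
    · obtain rfl := Fin.ext h
      rwa [add_sub_cancel_left]
    · exact sub_mem (add_mem (Submodule.smul_mem _ _ (single_mem_dualFiltration v h)) hsum)
        (Submodule.smul_mem _ _ (single_mem_dualFiltration v h))
  · have := dualAct_mem_dualFiltration M ((hS w).1 hw)
    rwa [map_sub, map_smul, dualAct_unitMatrixAct] at this

/-- An eigenvalue of the matrix of matrix units on a highest weight module is one of the roots
`μ k + m - k` (with `k` counted from one) of its characteristic identity. -/
theorem IsHighestWeightGenerator.eq_zero_of_unitMatrixAct_eq_smul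
    (hv : IsHighestWeightGenerator μ v) {κ : ℂ} (hκ : ∀ k : Fin m, μ k + (m - 1 - k) ≠ κ)
    {w : Fin m → W} (hw : unitMatrixAct m W w = κ • w) : w = 0 := by
  -- On each quotient of the filtration κ differs from the only possible eigenvalue, so `w` is
  -- pushed down step by step until it lies in the zero step.
  have key : ∀ k ≤ m, w ∈ dualFiltration v k := by
    intro k
    induction k with
    | zero => exact fun _ => hv.mem_dualFiltration_zero w
    | succ k ih =>
      intro hk
      have := hv.sub_smul_mem_dualFiltration ⟨k, hk⟩ (ih (by omega))
      rw [hw, ← sub_smul] at this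
      exact (Submodule.smul_mem_iff _ (sub_ne_zero.2 (hκ ⟨k, hk⟩).symm)).1 this
  have := key m le_rfl
  rwa [dualFiltration_eq_bot, Submodule.mem_bot] at this

end CharacteristicIdentity

/-! ### Homogeneous components in the model -/

section Homogeneous

open MvPolynomial

variable {m : ℕ} {V : Type} [AddCommGroup V] [Module ℂ V]

/-- The projection of `ℂ[y₁, …, y_m] ⊗ V` to its homogeneous component of degree `k`. -/
noncomputable def homProj (k : ℕ) : Module.End ℂ (PolyTensor m V) :=
  (homogeneousComponent k).rTensor V

theorem homProj_tmul (k : ℕ) (p : MvPolynomial (Fin m) ℂ) (v : V) :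
    homProj k (p ⊗ₜ v) = homogeneousComponent k p ⊗ₜ v := rfl

theorem homogeneousComponent_pderiv (k : ℕ) (t : Fin m) (p : MvPolynomial (Fin m) ℂ) :
    homogeneousComponent k (pderiv t p) = pderiv t (homogeneousComponent (k + 1) p) := by
  ext d
  have : (d + Finsupp.single t 1).degree = d.degree + 1 := by
    rw [map_add, Finsupp.degree_single]
  rw [coeff_pderiv, coeff_homogeneousComponent, coeff_homogeneousComponent, coeff_pderiv, this]
  simp only [add_left_inj]
  split_ifs <;> simp

theorem homogeneousComponent_euler (k : ℕ) (p : MvPolynomial (Fin m) ℂ) :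
    homogeneousComponent k (∑ t, X t * pderiv t p) = (k : ℂ) • homogeneousComponent k p := by
  induction p using MvPolynomial.induction_on' with
  | monomial d a =>
    have h1 : ∑ t, X t * pderiv t (monomial d a) = (d.degree : ℂ) • monomial d a := by
      simp_rw [X_mul_pderiv_monomial]
      rw [← Finset.sum_smul, ← Finsupp.degree_eq_sum, Nat.cast_smul_eq_nsmul]
    rw [h1, map_smul, homogeneousComponent_of_mem
      ((mem_homogeneousSubmodule d.degree _).2 (isHomogeneous_monomial a rfl))]
    split_ifs with h
    · rw [h]
    · simp
  | add p q hp hq => simp only [map_add, mul_add, Finset.sum_add_distrib, hp, hq, smul_add]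

variable (ρ : Gl m →ₗ⁅ℂ⁆ Module.End ℂ V)

theorem homProj_D (k : ℕ) (t : Fin m) (w : PolyTensor m V) :
    homProj k ((polyWeylGl ρ).D t w) = (polyWeylGl ρ).D t (homProj (k + 1) w) := by
  induction w using TensorProduct.induction_on with
  | zero => simp
  | tmul p v =>
    rw [polyWeylGl_D_tmul, homProj_tmul, homProj_tmul, polyWeylGl_D_tmul,
      homogeneousComponent_pderiv]
  | add x y hx hy => simp only [map_add, hx, hy]

theorem homProj_E (k : ℕ) (s t : Fin m) (w : PolyTensor m V) :
    homProj k ((polyWeylGl ρ).E s t w) = (polyWeylGl ρ).E s t (homProj k w) := by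
  induction w using TensorProduct.induction_on with
  | zero => simp
  | tmul p v => rfl
  | add x y hx hy => simp only [map_add, hx, hy]

theorem homProj_euler (k : ℕ) (w : PolyTensor m V) :
    homProj k (∑ t, (polyWeylGl ρ).Y t ((polyWeylGl ρ).D t w)) = (k : ℂ) • homProj k w := by
  induction w using TensorProduct.induction_on with
  | zero => simp
  | tmul p v =>
    simp only [polyWeylGl_D_tmul, polyWeylGl_Y_tmul]
    rw [← TensorProduct.sum_tmul, homProj_tmul, homogeneousComponent_euler, homProj_tmul,
      TensorProduct.smul_tmul']
  | add x y hx hy => simp only [map_add, Finset.sum_add_distrib, smul_add] at hx hy ⊢; rw [hx, hy]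

theorem homProj_homProj (k : ℕ) (w : PolyTensor m V) : homProj k (homProj k w) = homProj k w := by
  induction w using TensorProduct.induction_on with
  | zero => simp
  | tmul p v =>
    rw [homProj_tmul, homProj_tmul, homogeneousComponent_of_mem
      (homogeneousComponent_mem k p), if_pos rfl]
  | add x y hx hy => simp only [map_add, hx, hy]

theorem exists_sum_homProj (w : PolyTensor m V) :
    ∃ N : ℕ, ∀ n ≥ N, homProj n w = 0 ∧ ∑ k ∈ Finset.range n, homProj k w = w := by
  induction w using TensorProduct.induction_on with
  | zero => exact ⟨0, fun n _ => by simp⟩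
  | tmul p v =>
    refine ⟨p.totalDegree + 1, fun n hn => ?_⟩
    simp only [homProj_tmul]
    have h : ∀ k, p.totalDegree < k → homogeneousComponent k p = 0 :=
      fun k hk => homogeneousComponent_eq_zero k p hk
    refine ⟨by rw [h n (by omega), TensorProduct.zero_tmul], ?_⟩
    rw [← TensorProduct.sum_tmul]
    congr 1
    conv_rhs => rw [← sum_homogeneousComponent p]
    refine (Finset.sum_subset (Finset.range_mono hn) fun k _ hk => h k ?_).symm
    rw [Finset.mem_range] at hk
    omega
  | add x y hx hy =>
    obtain ⟨N, hN⟩ := hx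
    obtain ⟨N', hN'⟩ := hy
    refine ⟨max N N', fun n hn => ?_⟩
    have h1 := hN n (le_trans (le_max_left _ _) hn)
    have h2 := hN' n (le_trans (le_max_right _ _) hn)
    simp only [map_add, Finset.sum_add_distrib]
    rw [h1.1, h2.1, h1.2, h2.2, add_zero]
    exact ⟨rfl, rfl⟩

theorem exists_homProj_zero_eq (w : PolyTensor m V) : ∃ v : V, homProj 0 w = 1 ⊗ₜ v := by
  induction w using TensorProduct.induction_on with
  | zero => exact ⟨0, by simp⟩
  | tmul p v =>
    refine ⟨coeff 0 p • v, ?_⟩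
    rw [homProj_tmul, homogeneousComponent_zero, TensorProduct.tmul_smul, TensorProduct.smul_tmul',
      smul_eq_C_mul, mul_one]
  | add x y hx hy =>
    obtain ⟨v, hv⟩ := hx
    obtain ⟨v', hv'⟩ := hy
    exact ⟨v + v', by rw [map_add, hv, hv', TensorProduct.tmul_add]⟩

theorem exists_eq_one_tmul_of_homProj_eq_zero {w : PolyTensor m V}
    (h : ∀ k, homProj (k + 1) w = 0) : ∃ v : V, w = 1 ⊗ₜ v := by
  obtain ⟨N, hN⟩ := exists_sum_homProj w
  have := (hN (N + 1) (Nat.le_succ N)).2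
  rw [Finset.sum_range_succ', Finset.sum_eq_zero fun k _ => h k, zero_add] at this
  rw [← this]
  exact exists_homProj_zero_eq w

theorem coeffTensor_E (d : Fin m →₀ ℕ) (s t : Fin m) (w : PolyTensor m V) :
    coeffTensor d ((polyWeylGl ρ).E s t w) = ρ (Matrix.single s t 1) (coeffTensor d w) := by
  induction w using TensorProduct.induction_on with
  | zero => simp
  | tmul p v => rw [polyWeylGl_E_tmul, coeffTensor_tmul, coeffTensor_tmul, map_smul]
  | add x y hx hy => simp only [map_add, hx, hy]

theorem polyWeylGl_X_zero_apply (s : Fin m) (w : PolyTensor m V) :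
    (polyWeylGl ρ).X 0 s w = ∑ t, (polyWeylGl ρ).E s t ((polyWeylGl ρ).D t w) -
      ∑ t, (polyWeylGl ρ).Y t ((polyWeylGl ρ).D t ((polyWeylGl ρ).D s w)) := by
  have h : ∀ t, (polyWeylGl ρ).D s ((polyWeylGl ρ).D t w) =
      (polyWeylGl ρ).D t ((polyWeylGl ρ).D s w) := fun t =>
    DFunLike.congr_fun ((polyWeylGl ρ).D_mul_D s t) w
  simp only [WeylGl.X, WeylGl.A, map_zero, zero_mul, LinearMap.sum_apply,
    Module.End.mul_apply, LinearMap.sub_apply, LinearMap.zero_apply, sub_zero,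
    Finset.sum_sub_distrib, h]

/-- The second-order part of X_s is the Euler operator applied to D_s w, hence the scalar k in
degree k. -/
theorem homProj_X (k : ℕ) (s : Fin m) (w : PolyTensor m V) :
    homProj k ((polyWeylGl ρ).X 0 s w) =
      ∑ t, (polyWeylGl ρ).E s t ((polyWeylGl ρ).D t (homProj (k + 1) w)) -
        (k : ℂ) • (polyWeylGl ρ).D s (homProj (k + 1) w) := by
  rw [polyWeylGl_X_zero_apply, map_sub, homProj_euler, map_sum, homProj_D]
  simp only [homProj_E, homProj_D]

theorem eq_top_of_one_tmul_mem {N : Submodule ℂ (PolyTensor m V)}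
    (hN : ∀ t, ∀ w ∈ N, (polyWeylGl ρ).Y t w ∈ N) (h : ∀ v : V, 1 ⊗ₜ v ∈ N) : N = ⊤ := by
  have key : ∀ (p : MvPolynomial (Fin m) ℂ) (v : V), p ⊗ₜ v ∈ N := by
    intro p v
    induction p using MvPolynomial.induction_on with
    | C a =>
      rw [← mul_one (C a), ← smul_eq_C_mul, ← TensorProduct.smul_tmul']
      exact N.smul_mem a (h v)
    | add p q hp hq => rw [TensorProduct.add_tmul]; exact N.add_mem hp hq
    | mul_X p t hp =>
      have := hN t _ hp
      rwa [polyWeylGl_Y_tmul, mul_comm] at this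
  refine eq_top_iff.2 fun w _ => ?_
  induction w using TensorProduct.induction_on with
  | zero => exact N.zero_mem
  | tmul p v => exact key p v
  | add x y hx hy => exact N.add_mem (hx trivial) (hy trivial)

/-- The traceless block diagonal matrix with a given upper left block. -/
noncomputable def leviMatrix (M : Gl m) : Gl (m + 1) :=
  Matrix.of fun i j => Fin.lastCases (Fin.lastCases (-M.trace) (fun _ => 0) j)
    (fun s => Fin.lastCases 0 (fun t => M s t) j) i

theorem trace_leviMatrix (M : Gl m) : (leviMatrix M).trace = 0 := by
  simp [leviMatrix, Matrix.trace, Fin.sum_univ_castSucc]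

/-- The corner entry -tr M, needed for trace zero, acts by 0 on constants because the parameter is
0. -/
theorem polyRep_leviMatrix (M : Gl m) (v : V) :
    polyRep ρ 0 (leviMatrix M) (1 ⊗ₜ v) = 1 ⊗ₜ ρ M v := by
  have h : (Matrix.of fun i j : Fin m => leviMatrix M i.castSucc j.castSucc) = M := by
    ext i j
    simp [leviMatrix]
  rw [polyRep_one_tmul, h]
  simp [leviMatrix]

end Homogeneous

/-! ### Simplicity of the model -/

section Irreducible

open MvPolynomial

variable {m : ℕ} {V : Type} [AddCommGroup V] [Module ℂ V] [LieRingModule (Gl m) V]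
  [LieModule ℂ (Gl m) V]

/-- If no natural number is an eigenvalue of the matrix of matrix units on `V`, then the vectors
annihilated by the last column are those of degree zero. -/
theorem exists_eq_one_tmul_of_X_eq_zero
    (hV : ∀ (k : ℕ) (w : Fin m → V), unitMatrixAct m V w = (k : ℂ) • w → w = 0)
    {w : PolyTensor m V}
    (hw : ∀ s, (polyWeylGl (LieModule.toEnd ℂ (Gl m) V)).X 0 s w = 0) : ∃ v : V, w = 1 ⊗ₜ v := by
  set 𝒲 := polyWeylGl (LieModule.toEnd ℂ (Gl m) V) with h𝒲
  refine exists_eq_one_tmul_of_homProj_eq_zero fun k => ?_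
  have h1 : ∀ s, ∑ t, 𝒲.E s t (𝒲.D t (homProj (k + 1) w)) =
      (k : ℂ) • 𝒲.D s (homProj (k + 1) w) := by
    intro s
    have := homProj_X (LieModule.toEnd ℂ (Gl m) V) k s w
    rw [← h𝒲, hw, map_zero] at this
    exact (sub_eq_zero.1 this.symm)
  have h2 : ∀ s, 𝒲.D s (homProj (k + 1) w) = 0 := by
    intro s
    refine eq_zero_of_coeffTensor fun d => ?_
    -- For each monomial, the coefficients of the m derivatives form a column in V^m with eigenvalue
    -- `k`.
    refine congrFun (hV k (fun s => coeffTensor d (𝒲.D s (homProj (k + 1) w))) ?_) s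
    ext s
    have := congrArg (coeffTensor d) (h1 s)
    rw [map_sum, map_smul] at this
    simp only [h𝒲, coeffTensor_E] at this
    rw [unitMatrixAct_apply]
    exact this
  -- With all derivatives zero, Euler's identity gives (k + 1) times the component equal to 0.
  have h3 := homProj_euler (LieModule.toEnd ℂ (Gl m) V) (k + 1) (homProj (k + 1) w)
  rw [← h𝒲, Finset.sum_eq_zero fun t _ => by rw [h2, map_zero], map_zero, homProj_homProj] at h3
  exact (smul_eq_zero.1 h3.symm).resolve_left (Nat.cast_ne_zero.2 k.succ_ne_zero)

/-- A nonzero subspace stable under the last column contains a nonzero vector of degree zero. -/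
theorem exists_one_tmul_mem
    (hV : ∀ (k : ℕ) (w : Fin m → V), unitMatrixAct m V w = (k : ℂ) • w → w = 0)
    {N : Submodule ℂ (PolyTensor m V)}
    (hN : ∀ s, ∀ w ∈ N, (polyWeylGl (LieModule.toEnd ℂ (Gl m) V)).X 0 s w ∈ N)
    (h0 : N ≠ ⊥) : ∃ v : V, v ≠ 0 ∧ 1 ⊗ₜ v ∈ N := by
  -- Induction on a degree bound: either all X_s kill `w`, which then has degree 0, or some X_s w is
  -- nonzero of smaller degree bound.
  have key : ∀ (n : ℕ) (w : PolyTensor m V), w ∈ N → w ≠ 0 → (∀ k ≥ n, homProj (k + 1) w = 0) →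
      ∃ v : V, v ≠ 0 ∧ 1 ⊗ₜ v ∈ N := by
    intro n
    induction n with
    | zero =>
      intro w hw hw0 h
      obtain ⟨v, rfl⟩ := exists_eq_one_tmul_of_homProj_eq_zero fun k => h k (Nat.zero_le k)
      exact ⟨v, fun hv => hw0 (by rw [hv, TensorProduct.tmul_zero]), hw⟩
    | succ n ih =>
      intro w hw hw0 h
      by_cases hX : ∀ s, (polyWeylGl (LieModule.toEnd ℂ (Gl m) V)).X 0 s w = 0
      · obtain ⟨v, rfl⟩ := exists_eq_one_tmul_of_X_eq_zero hV hX
        exact ⟨v, fun hv => hw0 (by rw [hv, TensorProduct.tmul_zero]), hw⟩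
      · obtain ⟨s, hs⟩ := not_forall.1 hX
        refine ih _ (hN s w hw) hs fun k hk => ?_
        simp [homProj_X, h (k + 1) (by omega)]
  obtain ⟨w, hw, hw0⟩ := (Submodule.ne_bot_iff N).1 h0
  obtain ⟨n, hn⟩ := exists_sum_homProj w
  exact key n w hw hw0 fun k hk => (hn (k + 1) (by omega)).1

/-- The v with 1 ⊗ v in N form a gl(m)-submodule, stable through traceless block diagonal matrices.
It is nonzero, hence all of V. -/
theorem polyTensor_eq_top [LieModule.IsIrreducible ℂ (Gl m) V]
    (hV : ∀ (k : ℕ) (w : Fin m → V), unitMatrixAct m V w = (k : ℂ) • w → w = 0)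
    {N : Submodule ℂ (PolyTensor m V)}
    (hN : ∀ M : Gl (m + 1), M.trace = 0 →
      ∀ w ∈ N, polyRep (LieModule.toEnd ℂ (Gl m) V) 0 M w ∈ N) (h0 : N ≠ ⊥) : N = ⊤ := by
  have hX : ∀ s, ∀ w ∈ N, (polyWeylGl (LieModule.toEnd ℂ (Gl m) V)).X 0 s w ∈ N := by
    intro s w hw
    have := hN (Matrix.single s.castSucc (Fin.last m) 1)
      (Matrix.trace_single_eq_of_ne _ _ _ (Fin.castSucc_ne_last s)) w hw
    rwa [polyRep_single, WeylGl.op_castSucc_last] at this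
  have hY : ∀ t, ∀ w ∈ N, (polyWeylGl (LieModule.toEnd ℂ (Gl m) V)).Y t w ∈ N := by
    intro t w hw
    have := hN (Matrix.single (Fin.last m) t.castSucc 1)
      (Matrix.trace_single_eq_of_ne _ _ _ (Fin.castSucc_ne_last t).symm) w hw
    rwa [polyRep_single, WeylGl.op_last_castSucc] at this
  obtain ⟨v, hv, hvN⟩ := exists_one_tmul_mem hV hX h0
  let N₀ : LieSubmodule ℂ (Gl m) V :=
    { N.comap (TensorProduct.mk ℂ (MvPolynomial (Fin m) ℂ) V 1) with
      lie_mem := fun {M x} hx => by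
        have := hN (leviMatrix M) (trace_leviMatrix M) _ hx
        rw [TensorProduct.mk_apply, polyRep_leviMatrix] at this
        exact this }
  have hvN₀ : v ∈ N₀ := hvN
  have hN₀ : N₀ = ⊤ := (eq_bot_or_eq_top N₀).resolve_left fun h =>
    hv ((LieSubmodule.mem_bot v).1 (by rwa [h] at hvN₀))
  refine eq_top_of_one_tmul_mem _ hY fun v => ?_
  have : v ∈ N₀ := by rw [hN₀]; trivial
  exact this

end Irreducible

/-! ### Transfer to the generalized Verma module -/

section GenVerma

open MvPolynomial

open scoped IsMulCommutative in
/-- Pairwise commuting elements of an algebra can be substituted for the variables of a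
polynomial. -/
theorem exists_algHom_of_commute {R A σ : Type} [CommRing R] [Ring A] [Algebra R A] (y : σ → A)
    (h : ∀ i j, y i * y j = y j * y i) :
    ∃ θ : MvPolynomial σ R →ₐ[R] A, ∀ i, θ (X i) = y i := by
  have := Algebra.isMulCommutative_adjoin R (s := Set.range y) (by
    rintro _ ⟨i, rfl⟩ _ ⟨j, rfl⟩
    exact h i j)
  let z : σ → Algebra.adjoin R (Set.range y) :=
    fun i => ⟨y i, Algebra.subset_adjoin (Set.mem_range_self i)⟩
  refine ⟨(Algebra.adjoin R (Set.range y)).val.comp (aeval z), fun i => ?_⟩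
  rw [AlgHom.comp_apply, aeval_X]
  rfl

variable {m : ℕ}

/-- The matrix units of the last row as elements of `sl(m+1)`. -/
noncomputable def lastRowUnit (t : Fin m) : Sl (m + 1) :=
  ⟨Matrix.single (Fin.last m) t.castSucc 1,
    Matrix.trace_single_eq_of_ne _ _ _ (Fin.castSucc_ne_last t).symm⟩

theorem lie_lastRowUnit (s t : Fin m) : ⁅lastRowUnit s, lastRowUnit t⁆ = 0 := by
  refine Subtype.ext ?_
  change (Matrix.single (Fin.last m) s.castSucc 1 : Gl (m + 1)) *
    Matrix.single (Fin.last m) t.castSucc 1 -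
    Matrix.single (Fin.last m) t.castSucc 1 * Matrix.single (Fin.last m) s.castSucc 1 = 0
  rw [Matrix.single_mul_single_of_ne _ _ _ _ (Fin.castSucc_ne_last s),
    Matrix.single_mul_single_of_ne _ _ _ _ (Fin.castSucc_ne_last t), sub_zero]

theorem ι_lastRowUnit_commute (s t : Fin m) :
    UniversalEnvelopingAlgebra.ι ℂ (lastRowUnit s) * UniversalEnvelopingAlgebra.ι ℂ (lastRowUnit t) =
      UniversalEnvelopingAlgebra.ι ℂ (lastRowUnit t) *
        UniversalEnvelopingAlgebra.ι ℂ (lastRowUnit s) := by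
  rw [← sub_eq_zero, ← LieRing.of_associative_ring_bracket, ← LieHom.map_lie, lie_lastRowUnit,
    map_zero]

variable (m) (V : Type) [AddCommGroup V] [Module ℂ V] [LieRingModule (Gl m) V]
  [LieModule ℂ (Gl m) V]

/-- The representation of `sl(m+1)` on `ℂ[y₁, …, y_m] ⊗ V`. -/
noncomputable def slPolyRep : Sl (m + 1) →ₗ⁅ℂ⁆ Module.End ℂ (PolyTensor m V) :=
  (polyRep (LieModule.toEnd ℂ (Gl m) V) 0).comp (Sl (m + 1)).incl

variable {m V}

theorem slPolyRep_one_tmul (g : Sl (m + 1)) (v : V) :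
    slPolyRep m V g (1 ⊗ₜ v) =
      1 ⊗ₜ ⁅(Matrix.of fun i j : Fin m => (g : Gl (m + 1)) i.castSucc j.castSucc : Gl m), v⁆ +
        ∑ t, (g : Gl (m + 1)) (Fin.last m) t.castSucc •
          (X t : MvPolynomial (Fin m) ℂ) ⊗ₜ[ℂ] v := by
  refine (polyRep_one_tmul (LieModule.toEnd ℂ (Gl m) V) 0 (g : Gl (m + 1)) v).trans ?_
  rw [mul_zero, zero_smul, add_zero]
  rfl

theorem slPolyRep_lastRowUnit (t : Fin m) (w : PolyTensor m V) :
    slPolyRep m V (lastRowUnit t) w = (polyWeylGl (LieModule.toEnd ℂ (Gl m) V)).Y t w := by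
  change polyRep (LieModule.toEnd ℂ (Gl m) V) 0 (Matrix.single (Fin.last m) t.castSucc 1) w = _
  rw [polyRep_single, WeylGl.op_last_castSucc]

variable (m V)

/-- The canonical map from `V` to the generalized Verma module. -/
noncomputable abbrev GenVerma.of : V →ₗ[ℂ] GenVerma m V :=
  Ind.of (parabolic m) ((LieModule.toEnd ℂ (Gl m) V).comp (leviProj m))

/-- The parabolic has no last row off the diagonal, so v ↦ 1 ⊗ v into the model is equivariant and
factors through the induced module. -/
theorem GenVerma.of_injective : Function.Injective (GenVerma.of m V) := by
  obtain ⟨g, -, hg⟩ := Ind.exists_lift (P := parabolic m)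
    (ρ := (LieModule.toEnd ℂ (Gl m) V).comp (leviProj m)) (slPolyRep m V)
    (TensorProduct.mk ℂ (MvPolynomial (Fin m) ℂ) V 1) fun x v => by
      rw [TensorProduct.mk_apply, TensorProduct.mk_apply, slPolyRep_one_tmul,
        Finset.sum_eq_zero fun t _ => by rw [x.2 t, zero_smul], add_zero]
      rfl
  refine (injective_iff_map_eq_zero _).2 fun v hv => one_tmul_injective (m := m) v ?_
  have := hg v
  rw [hv, map_zero] at this
  exact this.symm

variable {m V} in
-- Subtracting its last row from g leaves an element of the parabolic, whose action on V is known.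
theorem GenVerma.lie_of (g : Sl (m + 1)) (v : V) :
    ⁅g, GenVerma.of m V v⁆ =
      GenVerma.of m V
        ⁅(Matrix.of fun i j : Fin m => (g : Gl (m + 1)) i.castSucc j.castSucc : Gl m), v⁆ +
        ∑ t, (g : Gl (m + 1)) (Fin.last m) t.castSucc • ⁅lastRowUnit t, GenVerma.of m V v⁆ := by
  set p : Sl (m + 1) := g - ∑ t, (g : Gl (m + 1)) (Fin.last m) t.castSucc • lastRowUnit t with hp
  have hcoe : (p : Gl (m + 1)) = (g : Gl (m + 1)) - ∑ t : Fin m, (g : Gl (m + 1)) (Fin.last m) t.castSucc •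
      (Matrix.single (Fin.last m) t.castSucc 1 : Gl (m + 1)) := by
    rw [hp]
    simp [lastRowUnit]
  have hmem : p ∈ parabolic m := by
    intro j
    rw [hcoe]
    simp [Matrix.sub_apply, Matrix.sum_apply, Matrix.single_apply]
  have hlevi : leviProj m ⟨p, hmem⟩ =
      (Matrix.of fun i j : Fin m => (g : Gl (m + 1)) i.castSucc j.castSucc : Gl m) := by
    ext i j
    change (p : Gl (m + 1)) i.castSucc j.castSucc = _
    rw [hcoe]
    simp [Matrix.sub_apply, Matrix.sum_apply, (Fin.castSucc_ne_last i).symm]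
  have h := Ind.lie_of (parabolic m) ((LieModule.toEnd ℂ (Gl m) V).comp (leviProj m)) ⟨p, hmem⟩ v
  rw [LieHom.comp_apply, hlevi] at h
  have hg : ⁅g, GenVerma.of m V v⁆ = ⁅p, GenVerma.of m V v⁆ +
      ⁅∑ t, (g : Gl (m + 1)) (Fin.last m) t.castSucc • lastRowUnit t, GenVerma.of m V v⁆ := by
    rw [← add_lie, hp, sub_add_cancel]
  rw [hg, sum_lie]
  simp only [smul_lie]
  exact congrArg (· + _) h

/-- Polynomials in the matrix units of the last row map `ℂ[y₁, …, y_m] ⊗ V` equivariantly to the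
generalized Verma module. -/
theorem GenVerma.exists_equivariant : ∃ Φ : PolyTensor m V →ₗ[ℂ] GenVerma m V,
    (∀ v, Φ (1 ⊗ₜ v) = GenVerma.of m V v) ∧
      ∀ (g : Sl (m + 1)) w, Φ (slPolyRep m V g w) = ⁅g, Φ w⁆ := by
  obtain ⟨θ, hθ⟩ := exists_algHom_of_commute (R := ℂ)
    (fun t : Fin m => UniversalEnvelopingAlgebra.ι ℂ (lastRowUnit t)) ι_lastRowUnit_commute
  let Φ : PolyTensor m V →ₗ[ℂ] GenVerma m V := TensorProduct.lift
    (LinearMap.mk₂ ℂ (fun p v => θ p • GenVerma.of m V v)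
      (fun p q v => by rw [map_add, add_smul]) (fun c p v => by rw [map_smul, smul_assoc])
      (fun p v w => by rw [map_add, smul_add]) (fun c p v => by rw [map_smul, smul_comm]))
  have hΦ : ∀ p v, Φ (p ⊗ₜ v) = θ p • GenVerma.of m V v := fun p v => rfl
  have hΦ1 : ∀ v, Φ (1 ⊗ₜ v) = GenVerma.of m V v := fun v => by rw [hΦ, map_one, one_smul]
  have hY : ∀ t w, Φ (slPolyRep m V (lastRowUnit t) w) = ⁅lastRowUnit t, Φ w⁆ := by
    intro t w
    rw [slPolyRep_lastRowUnit]
    induction w using TensorProduct.induction_on with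
    | zero => simp
    | tmul p v => rw [polyWeylGl_Y_tmul, hΦ, hΦ, map_mul, hθ, mul_smul, Ind.lie_def]
    | add x y hx hy => rw [map_add, map_add, hx, hy, map_add, lie_add]
  refine ⟨Φ, hΦ1, ?_⟩
  -- The vectors on which `Φ` is equivariant for every g include the constants, and by the Leibniz
  -- rule they are stable under each y_t, so they are everything.
  let N : Submodule ℂ (PolyTensor m V) :=
    { carrier := {w | ∀ g : Sl (m + 1), Φ (slPolyRep m V g w) = ⁅g, Φ w⁆}
      add_mem' := fun {a b} ha hb g => by rw [map_add, map_add, ha, hb, map_add, lie_add]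
      zero_mem' := fun g => by simp
      smul_mem' := fun c a ha g => by rw [map_smul, map_smul, ha, map_smul, lie_smul] }
  have hN : N = ⊤ := by
    refine eq_top_of_one_tmul_mem (LieModule.toEnd ℂ (Gl m) V) (fun t w hw g => ?_) fun v g => ?_
    · have h := DFunLike.congr_fun (LieHom.map_lie (slPolyRep m V) g (lastRowUnit t)) w
      rw [LieRing.of_associative_ring_bracket] at h
      have h' := eq_add_of_sub_eq h.symm
      rw [Module.End.mul_apply, Module.End.mul_apply] at h'
      rw [← slPolyRep_lastRowUnit, h', map_add, hw, hY, hw, hY, ← leibniz_lie]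
    · have hX : ∀ t, Φ (X t ⊗ₜ v) = ⁅lastRowUnit t, GenVerma.of m V v⁆ := fun t => by
        rw [hΦ, hθ, Ind.lie_def]
      rw [slPolyRep_one_tmul, map_add, map_sum, hΦ1, hΦ1, GenVerma.lie_of]
      simp only [map_smul, hX]
  intro g w
  have hw : w ∈ N := by rw [hN]; trivial
  exact hw g

/-- Submodules are pulled back along the surjection from the model; surjectivity makes the preimage
of a nonzero submodule nonzero, and injectivity of this map is not needed. -/
theorem GenVerma.isIrreducible [LieModule.IsIrreducible ℂ (Gl m) V]
    (hV : ∀ (k : ℕ) (w : Fin m → V), unitMatrixAct m V w = (k : ℂ) • w → w = 0) :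
    LieModule.IsIrreducible ℂ (Sl (m + 1)) (GenVerma m V) := by
  have : Nontrivial V := LieModule.nontrivial_of_isIrreducible ℂ (Gl m) V
  have : Nontrivial (GenVerma m V) := (GenVerma.of_injective m V).nontrivial
  refine LieModule.IsIrreducible.mk fun N hN => ?_
  obtain ⟨Φ, hΦ1, hΦ⟩ := GenVerma.exists_equivariant m V
  let R : LieSubmodule ℂ (Sl (m + 1)) (GenVerma m V) :=
    { LinearMap.range Φ with
      lie_mem := by
        rintro g _ ⟨w, rfl⟩
        exact ⟨slPolyRep m V g w, hΦ g w⟩ }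
  have hR : R = ⊤ := Ind.eq_top_of_forall_of_mem fun v => ⟨1 ⊗ₜ v, hΦ1 v⟩
  have hsurj : ∀ x, ∃ w, Φ w = x := by
    intro x
    have hx : x ∈ R := by rw [hR]; trivial
    exact hx
  obtain ⟨n, hn, hn0⟩ := (Submodule.ne_bot_iff (N : Submodule ℂ (GenVerma m V))).1
    fun h => hN (LieSubmodule.toSubmodule_eq_bot N |>.1 h)
  obtain ⟨w, rfl⟩ := hsurj n
  have htop : (N : Submodule ℂ (GenVerma m V)).comap Φ = ⊤ := by
    refine polyTensor_eq_top hV (fun M hM w hw => ?_) ?_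
    · have h := hΦ ⟨M, hM⟩ w
      change Φ (polyRep (LieModule.toEnd ℂ (Gl m) V) 0 M w) ∈ N
      change Φ (polyRep (LieModule.toEnd ℂ (Gl m) V) 0 M w) = _ at h
      rw [h]
      exact N.lie_mem hw
    · intro h
      have hw : w ∈ (N : Submodule ℂ (GenVerma m V)).comap Φ := hn
      rw [h, Submodule.mem_bot] at hw
      exact hn0 (by rw [hw, map_zero])
  refine Ind.eq_top_of_forall_of_mem fun v => ?_
  have hv : (1 : MvPolynomial (Fin m) ℂ) ⊗ₜ[ℂ] v ∈ (N : Submodule ℂ (GenVerma m V)).comap Φ := by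
    rw [htop]; trivial
  have hv' : Φ (1 ⊗ₜ v) ∈ N := hv
  rwa [hΦ1] at hv'

end GenVerma

theorem corollary4p8 (m : ℕ) (hm : 0 < m) (μ : Fin m → ℂ)
    (hμ : ∀ i : Fin m, ¬ ∃ n : ℕ, 0 < n ∧ μ i + (m : ℂ) + 1 = (n : ℂ)) :
    LieModule.IsIrreducible ℂ (Sl (m + 1)) (GenVerma m (SimpleHW m μ)) := by
  refine GenVerma.isIrreducible m (SimpleHW m μ) fun k w hw =>
    (SimpleHW.isHighestWeightGenerator m μ).eq_zero_of_unitMatrixAct_eq_smul (fun j hj => ?_) hw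
  -- With j counted from 0, μ_j + m - 1 - j = k means μ_j + m + 1 = k + j + 2.
  refine hμ j ⟨k + j + 2, by omega, ?_⟩
  push_cast
  rw [← hj]
  ring
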